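/- All graphs are simple. For a graph $G$ of bounded degree with vertex set $V$, let $A_G$ be its adjacency operator, $D_G$ its degree operator and $\Delta_G = D_G - A_G$ its Laplacian, i.e. $(\Delta_G f)(v)=\sum_{w\sim v}(f(v)-f(w))$; these are bounded self-adjoint operators on $\ell^2(V)$, whose canonical basis is $(\delta_v)_{v\in V}$. Let $X$ be a graph of bounded degree on a countably infinite set $V$, and let $\Gamma$ be a group of automorphisms of $X$ acting freely and with finitely many orbits on $V$. Let $(K_n)_{n\in\mathbb N}$ be an amenable exhaustion of $X$, that is, an increasing sequence of finite subsets of $V$ with union $V$ such that $|\mathcal F K_n|/|K_n|\to 0$, where $\mathcal F K_n$ is the set of vertices of $K_n$ adjacent in $X$ to a vertex outside $K_n$. Suppose that $X$ is connected or, if it is not, that there are a set $F$ of representatives of the $\Gamma$-orbits in $V$ and sets $E_n\subseteq\Gamma$ with $K_n\setminus\mathcal F K_n\subseteq E_nF\subseteq K_n$ for all $n$. For a bounded operator $T$ on $\ell^2(V)$ put $\tau_n(T)=\frac1{|K_n|}\sum_{v\in K_n}\langle\delta_v,T\delta_v\rangle$. Call a bounded operator essentially zero if it is a linear combination of bounded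 positive operators $S$ with $\tau_n(S)\to 0$. Let $Y$ be a graph of bounded degree on $V$ that is a density zero perturbation of $X$: $A_X-A_Y$ is essentially zero. For a bounded self-adjoint operator $H$ on $\ell^2(V)$, let $P_n$ be the orthogonal projection onto $\ell^2(K_n)$ and let $N_n$ be the eigenvalue counting measure (with multiplicity) of $P_nHP_n$ on $\ell^2(K_n)$, divided by $|K_n|$. The integrated density of states of $H$ is the probability measure $N_H$ on $\mathbb R$, if there is one, such that for every bounded continuous $\varphi:\mathbb R\to\mathbb R$ both $\int\varphi\,dN_n\to\int\varphi\,dN_H$ and $\tau_n(\varphi(H))\to\int\varphi\,dN_H$. Put $$E_0(H)=\lim_{n}\,\inf\operatorname{supp}N_n,\qquad E_m(H)=\inf\operatorname{supp}N_H .$$ One says that $H$ has (low energy) hidden spectrum if $E_0(H)<E_m(H)$. **Theorem.** For the Hamiltonian $H=\Delta_Y$, the quantities $E_0(H)$ and $E_m(H)$ exist (in particular $N_H$ exists), and $H$ has no hidden spectrum. -/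

import Mathlib

open Filter Topology MeasureTheory
open scoped lp InnerProductSpace BoundedContinuousFunction

noncomputable section

namespace AmenableGraph

variable {V : Type*}

/-! ### Bounded operators on the square-summable functions on the vertices -/

open scoped Classical in
/-- The canonical basis vector `δ_v` of `ℓ²(V)`. -/
def delta (v : V) : ℓ²(V, ℂ) := lp.single 2 v 1

theorem inner_delta (v : V) (f : ℓ²(V, ℂ)) : ⟪delta v, f⟫_ℂ = f v := by
  classical
  have h := lp.inner_single_left (𝕜 := ℂ) (G := fun _ : V => ℂ) v 1 f
  unfold delta
  convert h using 1
  simp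

/-- The linear operator on `ℓ²(V)` induced by a linear map on functions that satisfies an
`ℓ²`-bound. -/
def operatorOfBound (L : (V → ℂ) →ₗ[ℂ] (V → ℂ))
    (hL : ∃ C : ℝ, 0 ≤ C ∧ ∀ (f : ℓ²(V, ℂ)) (s : Finset V),
      ∑ v ∈ s, ‖L f v‖ ^ 2 ≤ C ^ 2 * ‖f‖ ^ 2) :
    ℓ²(V, ℂ) →L[ℂ] ℓ²(V, ℂ) :=
  LinearMap.mkContinuousOfExistsBound
    { toFun := fun f => ⟨L f, by
        obtain ⟨C, _, h⟩ := hL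
        refine memℓp_gen' (C := C ^ 2 * ‖f‖ ^ 2) fun s => ?_
        simpa using h f s⟩
      map_add' := fun f g => by
        apply Subtype.ext
        exact L.map_add f g
      map_smul' := fun c f => by
        apply Subtype.ext
        exact L.map_smul c f } (by
    obtain ⟨C, hC, h⟩ := hL
    refine ⟨C, fun f => ?_⟩
    refine lp.norm_le_of_forall_sum_le (p := 2) (by simp) (by positivity) fun s => ?_
    simpa [mul_pow] using h f s)

theorem operatorOfBound_apply (L : (V → ℂ) →ₗ[ℂ] (V → ℂ)) (hL) (f : ℓ²(V, ℂ)) (v : V) :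
    operatorOfBound L hL f v = L f v := rfl

/-! ### Adjacency operator, degree operator and Laplacian of a graph of bounded degree -/

/-- The graph has bounded degree: `sup_v deg v < ∞`. -/
def BoundedDegree (G : SimpleGraph V) [G.LocallyFinite] : Prop :=
  ∃ d : ℕ, ∀ v, G.degree v ≤ d

theorem sum_sq_le (f : ℓ²(V, ℂ)) (s : Finset V) : ∑ v ∈ s, ‖f v‖ ^ 2 ≤ ‖f‖ ^ 2 := by
  have := lp.sum_rpow_le_norm_rpow (p := 2) (by simp) f s
  simpa using this

/-- `(A f)(v) = ∑_{w ∼ v} f(w)` on functions. -/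
def adjacencyMap (G : SimpleGraph V) [G.LocallyFinite] : (V → ℂ) →ₗ[ℂ] (V → ℂ) where
  toFun f v := ∑ w ∈ G.neighborFinset v, f w
  map_add' f g := by
    funext v
    simp [Finset.sum_add_distrib]
  map_smul' c f := by
    funext v
    simp [Finset.mul_sum]

/-- `(D f)(v) = deg(v) f(v)` on functions. -/
def degreeMap (G : SimpleGraph V) [G.LocallyFinite] : (V → ℂ) →ₗ[ℂ] (V → ℂ) where
  toFun f v := (G.degree v : ℂ) * f v
  map_add' f g := by
    funext v
    simp [mul_add]
  map_smul' c f := by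
    funext v
    simp [mul_left_comm]

theorem adjacencyMap_bound (G : SimpleGraph V) [G.LocallyFinite] (hG : BoundedDegree G) :
    ∃ C : ℝ, 0 ≤ C ∧ ∀ (f : ℓ²(V, ℂ)) (s : Finset V),
      ∑ v ∈ s, ‖adjacencyMap G f v‖ ^ 2 ≤ C ^ 2 * ‖f‖ ^ 2 := by
  classical
  obtain ⟨d, hd⟩ := hG
  refine ⟨d, by positivity, fun f s => ?_⟩
  have h1 : ∀ v, ‖adjacencyMap G f v‖ ^ 2 ≤ d * ∑ w ∈ G.neighborFinset v, ‖f w‖ ^ 2 := by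
    intro v
    calc ‖adjacencyMap G f v‖ ^ 2 ≤ (∑ w ∈ G.neighborFinset v, ‖f w‖) ^ 2 := by
          gcongr
          exact norm_sum_le _ _
      _ ≤ (G.neighborFinset v).card * ∑ w ∈ G.neighborFinset v, ‖f w‖ ^ 2 :=
          sq_sum_le_card_mul_sum_sq
      _ ≤ d * ∑ w ∈ G.neighborFinset v, ‖f w‖ ^ 2 := by
          gcongr
          simpa using hd v
  have h2 : ∑ v ∈ s, ∑ w ∈ G.neighborFinset v, ‖f w‖ ^ 2
      ≤ ∑ w ∈ s.biUnion (fun v => G.neighborFinset v), (d : ℝ) * ‖f w‖ ^ 2 := by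
    rw [Finset.sum_comm' (t' := s.biUnion (fun v => G.neighborFinset v))
      (s' := fun w => s.filter fun v => w ∈ G.neighborFinset v)]
    · refine Finset.sum_le_sum fun w _ => ?_
      rw [Finset.sum_const, nsmul_eq_mul]
      gcongr
      refine le_trans (Finset.card_le_card (t := G.neighborFinset w) ?_) (by simpa using hd w)
      intro v hv
      simp only [Finset.mem_filter, SimpleGraph.mem_neighborFinset] at hv ⊢
      exact hv.2.symm
    · intro v w
      simp only [Finset.mem_filter, Finset.mem_biUnion]
      constructor
      · rintro ⟨hv, hw⟩
        exact ⟨⟨hv, hw⟩, v, hv, hw⟩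
      · rintro ⟨h, _⟩
        exact h
  calc ∑ v ∈ s, ‖adjacencyMap G f v‖ ^ 2
      ≤ ∑ v ∈ s, d * ∑ w ∈ G.neighborFinset v, ‖f w‖ ^ 2 := Finset.sum_le_sum fun v _ => h1 v
    _ = d * ∑ v ∈ s, ∑ w ∈ G.neighborFinset v, ‖f w‖ ^ 2 := by rw [Finset.mul_sum]
    _ ≤ d * ∑ w ∈ s.biUnion (fun v => G.neighborFinset v), (d : ℝ) * ‖f w‖ ^ 2 := by gcongr
    _ = d ^ 2 * ∑ w ∈ s.biUnion (fun v => G.neighborFinset v), ‖f w‖ ^ 2 := by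
        rw [← Finset.mul_sum]
        ring
    _ ≤ (d : ℝ) ^ 2 * ‖f‖ ^ 2 := by
        gcongr
        exact sum_sq_le f _

theorem degreeMap_bound (G : SimpleGraph V) [G.LocallyFinite] (hG : BoundedDegree G) :
    ∃ C : ℝ, 0 ≤ C ∧ ∀ (f : ℓ²(V, ℂ)) (s : Finset V),
      ∑ v ∈ s, ‖degreeMap G f v‖ ^ 2 ≤ C ^ 2 * ‖f‖ ^ 2 := by
  obtain ⟨d, hd⟩ := hG
  refine ⟨d, by positivity, fun f s => ?_⟩
  calc ∑ v ∈ s, ‖degreeMap G f v‖ ^ 2 ≤ ∑ v ∈ s, (d : ℝ) ^ 2 * ‖f v‖ ^ 2 := by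
        refine Finset.sum_le_sum fun v _ => ?_
        have : ‖degreeMap G f v‖ = (G.degree v : ℝ) * ‖f v‖ := by simp [degreeMap]
        rw [this, mul_pow]
        gcongr
        exact hd v
    _ = (d : ℝ) ^ 2 * ∑ v ∈ s, ‖f v‖ ^ 2 := by rw [Finset.mul_sum]
    _ ≤ (d : ℝ) ^ 2 * ‖f‖ ^ 2 := by
        gcongr
        exact sum_sq_le f s

/-- The adjacency operator `A` on `ℓ²(V)`, `(A f)(v) = ∑_{w ∼ v} f(w)`. -/
def adjacency (G : SimpleGraph V) [G.LocallyFinite] (hG : BoundedDegree G) :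
    ℓ²(V, ℂ) →L[ℂ] ℓ²(V, ℂ) :=
  operatorOfBound (adjacencyMap G) (adjacencyMap_bound G hG)

/-- The degree operator `D` on `ℓ²(V)`, `(D f)(v) = deg(v) f(v)`. -/
def degreeOperator (G : SimpleGraph V) [G.LocallyFinite] (hG : BoundedDegree G) :
    ℓ²(V, ℂ) →L[ℂ] ℓ²(V, ℂ) :=
  operatorOfBound (degreeMap G) (degreeMap_bound G hG)

/-- The Laplacian `Δ = D - A` on `ℓ²(V)`. -/
def laplacian (G : SimpleGraph V) [G.LocallyFinite] (hG : BoundedDegree G) :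
    ℓ²(V, ℂ) →L[ℂ] ℓ²(V, ℂ) :=
  degreeOperator G hG - adjacency G hG

theorem adjacency_apply (G : SimpleGraph V) [G.LocallyFinite] (hG : BoundedDegree G)
    (f : ℓ²(V, ℂ)) (v : V) : adjacency G hG f v = ∑ w ∈ G.neighborFinset v, f w := rfl

theorem degreeOperator_apply (G : SimpleGraph V) [G.LocallyFinite] (hG : BoundedDegree G)
    (f : ℓ²(V, ℂ)) (v : V) : degreeOperator G hG f v = (G.degree v : ℂ) * f v := rfl

theorem laplacian_apply (G : SimpleGraph V) [G.LocallyFinite] (hG : BoundedDegree G)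
    (f : ℓ²(V, ℂ)) (v : V) :
    laplacian G hG f v = ∑ w ∈ G.neighborFinset v, (f v - f w) := by
  have : laplacian G hG f v = degreeOperator G hG f v - adjacency G hG f v := rfl
  rw [this, adjacency_apply, degreeOperator_apply, Finset.sum_sub_distrib, Finset.sum_const,
    nsmul_eq_mul, SimpleGraph.card_neighborFinset_eq_degree]

theorem delta_apply_comm (v w : V) : delta v w = delta w v := by
  classical
  unfold delta
  rw [lp.single_apply, lp.single_apply]
  simp [Pi.single_apply, eq_comm]

theorem adjacency_delta (G : SimpleGraph V) [G.LocallyFinite] (hG : BoundedDegree G) (v : V) :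
    adjacency G hG (delta v) = ∑ w ∈ G.neighborFinset v, delta w := by
  classical
  apply lp.ext
  funext u
  rw [adjacency_apply, lp.coeFn_sum, Finset.sum_apply]
  simp only [delta, lp.single_apply, Pi.single_apply, Finset.sum_ite_eq',
    Finset.sum_ite_eq, SimpleGraph.mem_neighborFinset, SimpleGraph.adj_comm]

theorem isSelfAdjoint_of_inner_delta (T : ℓ²(V, ℂ) →L[ℂ] ℓ²(V, ℂ))
    (h : ∀ (v : V) (f : ℓ²(V, ℂ)), ⟪T (delta v), f⟫_ℂ = T f v) : IsSelfAdjoint T := by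
  rw [ContinuousLinearMap.isSelfAdjoint_iff']
  refine ContinuousLinearMap.ext fun f => ?_
  apply lp.ext
  funext v
  rw [← inner_delta, ContinuousLinearMap.adjoint_inner_right, h]

theorem adjacency_isSelfAdjoint (G : SimpleGraph V) [G.LocallyFinite] (hG : BoundedDegree G) :
    IsSelfAdjoint (adjacency G hG) := by
  refine isSelfAdjoint_of_inner_delta _ fun v f => ?_
  rw [adjacency_delta, sum_inner, adjacency_apply]
  exact Finset.sum_congr rfl fun w _ => inner_delta w f

theorem degreeOperator_isSelfAdjoint (G : SimpleGraph V) [G.LocallyFinite]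
    (hG : BoundedDegree G) : IsSelfAdjoint (degreeOperator G hG) := by
  refine isSelfAdjoint_of_inner_delta _ fun v f => ?_
  have : degreeOperator G hG (delta v) = (G.degree v : ℂ) • delta v := by
    classical
    apply lp.ext
    funext u
    rw [degreeOperator_apply, lp.coeFn_smul, Pi.smul_apply, smul_eq_mul]
    by_cases huv : u = v
    · rw [huv]
    · simp [delta, lp.single_apply, huv]
  rw [this, inner_smul_left, inner_delta, degreeOperator_apply]
  simp

theorem laplacian_isSelfAdjoint (G : SimpleGraph V) [G.LocallyFinite] (hG : BoundedDegree G) :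
    IsSelfAdjoint (laplacian G hG) :=
  (degreeOperator_isSelfAdjoint G hG).sub (adjacency_isSelfAdjoint G hG)

/-! ### Periodic graphs and amenable exhaustions

A finite subgraph enters all the notions below through its vertex set only, so an exhaustion by
finite subgraphs is recorded as an increasing sequence of finite sets of vertices. -/

/-- `F` contains exactly one vertex of each orbit of `Γ`. -/
def IsFundamentalDomain {G : SimpleGraph V} (Γ : Subgroup (G ≃g G)) (F : Finset V) : Prop :=
  ∀ v : V, ∃! x : V, x ∈ F ∧ ∃ γ ∈ Γ, γ x = v

/-- `G` is periodic under the group `Γ` of automorphisms: `Γ` acts freely, with finitely many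
orbits, on the vertices. -/
structure IsPeriodic (G : SimpleGraph V) (Γ : Subgroup (G ≃g G)) : Prop where
  free : ∀ γ ∈ Γ, ∀ v : V, γ v = v → γ = 1
  cofinite : ∃ F : Finset V, IsFundamentalDomain Γ F

open scoped Classical in
/-- The vertices of `K` at graph distance one from the complement of `K`. -/
def boundary (G : SimpleGraph V) (K : Finset V) : Finset V :=
  K.filter fun v => ∃ w, w ∉ K ∧ G.Adj v w

/-- `K` is an amenable exhaustion of `G`. -/
structure IsAmenableExhaustion (G : SimpleGraph V) (K : ℕ → Finset V) : Prop where
  mono : Monotone K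
  exhausts : ∀ v : V, ∃ n, v ∈ K n
  boundary_ratio :
    Tendsto (fun n => ((boundary G (K n)).card : ℝ) / ((K n).card : ℝ)) atTop (𝓝 0)

/-- Up to its boundary, every `K n` is a finite union of translates of a fundamental domain
`F`: there are `E n ⊆ Γ` with `K n \ boundary ⊆ (E n) F ⊆ K n`. -/
def IsTiledExhaustion {G : SimpleGraph V} (Γ : Subgroup (G ≃g G)) (K : ℕ → Finset V) : Prop :=
  ∃ F : Finset V, IsFundamentalDomain Γ F ∧ ∃ E : ℕ → Set (G ≃g G),
    (∀ n, E n ⊆ (Γ : Set (G ≃g G))) ∧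
    (∀ n, ∀ γ ∈ E n, ∀ x ∈ F, γ x ∈ K n) ∧
    (∀ n, ∀ v ∈ K n, v ∉ boundary G (K n) → ∃ γ ∈ E n, ∃ x ∈ F, γ x = v)

/-! ### Trace per vertex and density zero perturbations -/

/-- `Tr(T P_K) / |K|`, where `P_K` is the orthogonal projection onto `ℓ²(K)`. -/
def meanTrace (K : Finset V) (T : ℓ²(V, ℂ) →L[ℂ] ℓ²(V, ℂ)) : ℂ :=
  (∑ v ∈ K, ⟪delta v, T (delta v)⟫_ℂ) / (K.card : ℂ)

/-- `T` is essentially zero along `K`: it is in the linear span of the positive operators `S`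
with `lim_n Tr(S P_n) / |K_n| = 0`. -/
def IsEssentiallyZero (K : ℕ → Finset V) (T : ℓ²(V, ℂ) →L[ℂ] ℓ²(V, ℂ)) : Prop :=
  T ∈ Submodule.span ℂ {S : ℓ²(V, ℂ) →L[ℂ] ℓ²(V, ℂ) |
    S.IsPositive ∧ Tendsto (fun n => meanTrace (K n) S) atTop (𝓝 0)}

/-- `Y` is a density zero perturbation of `X` (on the same vertices) along `K`. -/
def IsDensityZeroPerturbation (K : ℕ → Finset V) (X Y : SimpleGraph V)
    [X.LocallyFinite] [Y.LocallyFinite] (hX : BoundedDegree X) (hY : BoundedDegree Y) : Prop :=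
  IsEssentiallyZero K (adjacency X hX - adjacency Y hY)

/-! ### Density of states and hidden spectrum -/

/-- The matrix of the finite volume truncation `P_K H P_K`, as an operator on `ℓ²(K)`. -/
def truncation (K : Finset V) (H : ℓ²(V, ℂ) →L[ℂ] ℓ²(V, ℂ)) : Matrix K K ℂ :=
  Matrix.of fun v w => ⟪delta (v : V), H (delta (w : V))⟫_ℂ

theorem truncation_isHermitian (K : Finset V) {H : ℓ²(V, ℂ) →L[ℂ] ℓ²(V, ℂ)}
    (hH : IsSelfAdjoint H) : (truncation K H).IsHermitian := by
  refine Matrix.IsHermitian.ext fun v w => ?_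
  have h : ⟪H (delta (w : V)), delta (v : V)⟫_ℂ = ⟪delta (w : V), H (delta (v : V))⟫_ℂ :=
    hH.isSymmetric _ _
  simp only [truncation, Matrix.of_apply]
  rw [← h]
  exact inner_conj_symm _ _

open scoped Classical in
/-- The normalised eigenvalue counting measure of `P_K H P_K` (eigenvalues with multiplicity),
whose distribution function is `N_{H_K}(t) = |{eigenvalues ≤ t}| / |K|`. -/
def eigenvalueMeasure (K : Finset V) (H : ℓ²(V, ℂ) →L[ℂ] ℓ²(V, ℂ)) (hH : IsSelfAdjoint H) :
    Measure ℝ :=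
  (K.card : ENNReal)⁻¹ •
    ∑ i : K, Measure.dirac ((truncation_isHermitian K hH).eigenvalues i)

/-- The continuous functional calculus `φ(H)` of a self-adjoint operator on a Hilbert space. -/
def functionalCalculus {E : Type*} [NormedAddCommGroup E] [InnerProductSpace ℂ E]
    [CompleteSpace E] (φ : ℝ →ᵇ ℝ) (H : E →L[ℂ] E) : E →L[ℂ] E :=
  cfc (fun t : ℝ => φ t) H

/-- `N` is the integrated density of states `N_H` of `H` along `K`: the eigenvalue counting
measures converge weakly to `N`, and `N` is the spectral distribution of `H` in the trace
`τ(T) = lim_n Tr(T P_n) / |K_n|`, that is, `τ(φ(H)) = ∫ φ dN`. -/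
structure IsDensityOfStates (K : ℕ → Finset V) (H : ℓ²(V, ℂ) →L[ℂ] ℓ²(V, ℂ))
    (hH : IsSelfAdjoint H) (N : ProbabilityMeasure ℝ) : Prop where
  finite_volume : ∀ φ : ℝ →ᵇ ℝ,
    Tendsto (fun n => ∫ t, φ t ∂(eigenvalueMeasure (K n) H hH)) atTop
      (𝓝 (∫ t, φ t ∂(N : Measure ℝ)))
  trace : ∀ φ : ℝ →ᵇ ℝ,
    Tendsto (fun n => meanTrace (K n) (functionalCalculus φ H)) atTop
      (𝓝 ((∫ t, φ t ∂(N : Measure ℝ) : ℝ) : ℂ))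

/-- `e = E_0(H) = lim_n inf supp N_{H_{K_n}}`. -/
def IsGroundEnergy (K : ℕ → Finset V) (H : ℓ²(V, ℂ) →L[ℂ] ℓ²(V, ℂ))
    (hH : IsSelfAdjoint H) (e : ℝ) : Prop :=
  Tendsto (fun n => sInf (eigenvalueMeasure (K n) H hH).support) atTop (𝓝 e)

/-- `e = E_m(H) = inf supp N_H`. -/
def IsDensityOfStatesBottom (K : ℕ → Finset V) (H : ℓ²(V, ℂ) →L[ℂ] ℓ²(V, ℂ))
    (hH : IsSelfAdjoint H) (e : ℝ) : Prop :=
  ∃ N : ProbabilityMeasure ℝ, IsDensityOfStates K H hH N ∧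
    IsGLB (N : Measure ℝ).support e

/-- `H` has (low energy) hidden spectrum along `K`: `E_0(H) < E_m(H)`. -/
def HasHiddenSpectrum (K : ℕ → Finset V) (H : ℓ²(V, ℂ) →L[ℂ] ℓ²(V, ℂ))
    (hH : IsSelfAdjoint H) : Prop :=
  ∃ e₀ e₁ : ℝ, IsGroundEnergy K H hH e₀ ∧ IsDensityOfStatesBottom K H hH e₁ ∧ e₀ < e₁

end AmenableGraph

end

open Filter Topology MeasureTheory
open scoped lp InnerProductSpace BoundedContinuousFunction CompactlySupported

noncomputable section

namespace AmenableGraph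

variable {V : Type*}

/-! ### Basis vectors and coordinate projections -/

/-! Everything is reduced to moments. If `A_X - A_Y` is essentially zero, then the mean of `‖(A_X -
A_Y) δ_v‖²` over `K n` tends to `0`. Each vertex whose neighbourhood changed contributes at least
`1`, so such vertices have density zero. Together with amenability and bounded degree, this shows
that for fixed `k` most vertices of `K n` see only unperturbed vertices of `K n` within `k` steps.
There the `k`-th powers of `Δ_Y`, of its compression to `K n` and of `Δ_X` agree
(`pow_apply_eq_of_mem_span_good`), so all three have the same asymptotic mean trace.

For `Δ_X` the diagonal entries are `Γ`-invariant and the orbits are equidistributed along `K n`, so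
the mean traces converge to the average over a fundamental domain `F`. Weierstrass approximation
passes from moments to continuous functions (`IsMomentFunctional.tendsto`), and the Riesz theorem
turns the limit functional into the measure `N_H`.

The ground energy exists because the lowest eigenvalues of the truncations decrease in `n` and are
nonnegative, by Gershgorin; in particular `E_0 ≥ 0`. If `E_m > E_0`, then `E_m > 0`, and a
nonnegative `φ` dominating `E_m - t` on `[-‖Δ_X‖, ‖Δ_X‖]` has integral zero. The average over `F` is
faithful on invariant positive operators, so `φ(Δ_X) = 0` and `Δ_X ≥ E_m > 0`. The indicators of `K
n` contradict this, since their Rayleigh quotients for `Δ_X` are `O(|∂K n| / |K n|)`. -/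

open scoped Classical in
theorem delta_apply (v w : V) : delta v w = if w = v then 1 else 0 := by
  unfold delta
  rw [lp.single_apply]
  simp [Pi.single_apply]

theorem norm_delta (v : V) : ‖delta v‖ = 1 := by
  classical
  unfold delta
  rw [lp.norm_single (by simp)]
  simp

theorem norm_inner_delta_le (v : V) (T : ℓ²(V, ℂ) →L[ℂ] ℓ²(V, ℂ)) :
    ‖⟪delta v, T (delta v)⟫_ℂ‖ ≤ ‖T‖ := by
  refine (norm_inner_le_norm _ _).trans ?_
  have := T.le_opNorm (delta v)
  rw [norm_delta, mul_one] at this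
  rwa [norm_delta, one_mul]

theorem sum_smul_delta_apply [DecidableEq V] (s : Finset V) (c : V → ℂ) (w : V) :
    (∑ v ∈ s, c v • delta v) w = if w ∈ s then c w else 0 := by
  rw [lp.coeFn_sum, Finset.sum_apply]
  simp only [lp.coeFn_smul, Pi.smul_apply, delta_apply, smul_eq_mul, mul_ite, mul_one, mul_zero]
  simp

/-- The orthogonal projection of `ℓ²(V)` onto `ℓ²(K)`. -/
def coordProj (K : Finset V) : ℓ²(V, ℂ) →L[ℂ] ℓ²(V, ℂ) :=
  ∑ v ∈ K, (innerSL ℂ (delta v)).smulRight (delta v)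

theorem coordProj_eq_sum (K : Finset V) (f : ℓ²(V, ℂ)) :
    coordProj K f = ∑ v ∈ K, f v • delta v := by
  simp [coordProj, inner_delta]

theorem coordProj_apply [DecidableEq V] (K : Finset V) (f : ℓ²(V, ℂ)) (v : V) :
    coordProj K f v = if v ∈ K then f v else 0 := by
  rw [coordProj_eq_sum, sum_smul_delta_apply]

theorem norm_coordProj_le (K : Finset V) : ‖coordProj K‖ ≤ 1 := by
  classical
  refine ContinuousLinearMap.opNorm_le_bound _ zero_le_one fun f => ?_
  rw [one_mul]
  refine lp.norm_le_of_forall_sum_le (p := 2) (by simp) (norm_nonneg _) fun s => ?_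
  have h : ∑ v ∈ s, ‖coordProj K f v‖ ^ 2 ≤ ‖f‖ ^ 2 := by
    refine le_trans (Finset.sum_le_sum fun v _ => ?_) (sum_sq_le f s)
    rw [coordProj_apply]
    split_ifs
    · exact le_rfl
    · simp
  simpa using h

theorem coordProj_delta {K : Finset V} {v : V} (hv : v ∈ K) :
    coordProj K (delta v) = delta v := by
  classical
  apply lp.ext
  funext w
  rw [coordProj_apply, delta_apply]
  split_ifs with h1 h2 h2
  · rfl
  · rfl
  · exact absurd (h2 ▸ hv) h1
  · rfl

/-- The compression `P_K H P_K` as an operator on `ℓ²(V)`. -/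
def compression (K : Finset V) (H : ℓ²(V, ℂ) →L[ℂ] ℓ²(V, ℂ)) : ℓ²(V, ℂ) →L[ℂ] ℓ²(V, ℂ) :=
  coordProj K * H * coordProj K

theorem norm_compression_le (K : Finset V) (H : ℓ²(V, ℂ) →L[ℂ] ℓ²(V, ℂ)) :
    ‖compression K H‖ ≤ ‖H‖ := by
  unfold compression
  refine (norm_mul_le _ _).trans ?_
  refine (mul_le_mul (norm_mul_le _ _) (norm_coordProj_le K) (norm_nonneg _)
    (by positivity)).trans ?_
  rw [mul_one]
  exact mul_le_of_le_one_left (norm_nonneg _) (norm_coordProj_le K)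

theorem compression_delta (K : Finset V) (H : ℓ²(V, ℂ) →L[ℂ] ℓ²(V, ℂ)) {v : V} (hv : v ∈ K) :
    compression K H (delta v) = coordProj K (H (delta v)) := by
  simp [compression, coordProj_delta hv]

/-- Moves matrix powers to operators on the fixed space `ℓ²(V)`, so that truncations and `H` itself
can be treated by one argument. For `k = 0` the left side involves the identity rather than `P_K`,
which makes no difference on `δ_v` with `v ∈ K`. -/
theorem compression_pow_delta [DecidableEq V] (K : Finset V) (H : ℓ²(V, ℂ) →L[ℂ] ℓ²(V, ℂ))
    (k : ℕ) (v : K) :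
    (compression K H ^ k) (delta (v : V)) = ∑ w : K, (truncation K H ^ k) w v • delta (w : V) := by
  induction k generalizing v with
  | zero => simp [Matrix.one_apply, Finset.sum_ite_eq']
  | succ k ih =>
    rw [pow_succ, mul_apply_eq_comp, compression_delta K H v.2, coordProj_eq_sum,
      map_sum, ← Finset.sum_coe_sort K]
    simp only [map_smul, ih, Finset.smul_sum, smul_smul]
    rw [Finset.sum_comm]
    refine Finset.sum_congr rfl fun w _ => ?_
    rw [← Finset.sum_smul, pow_succ, Matrix.mul_apply]
    congr 1
    refine Finset.sum_congr rfl fun u _ => ?_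
    rw [mul_comm, truncation, Matrix.of_apply, inner_delta]

theorem truncation_pow_apply_self [DecidableEq V] (K : Finset V) (H : ℓ²(V, ℂ) →L[ℂ] ℓ²(V, ℂ))
    (k : ℕ) (v : K) :
    (truncation K H ^ k) v v = ⟪delta (v : V), (compression K H ^ k) (delta (v : V))⟫_ℂ := by
  rw [compression_pow_delta, inner_delta, lp.coeFn_sum, Finset.sum_apply]
  simp [delta_apply]

theorem trace_truncation_pow [DecidableEq V] (K : Finset V) (H : ℓ²(V, ℂ) →L[ℂ] ℓ²(V, ℂ))
    (k : ℕ) :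
    (truncation K H ^ k).trace / (K.card : ℂ) = meanTrace K (compression K H ^ k) := by
  rw [meanTrace, Matrix.trace, ← Finset.sum_coe_sort K]
  simp only [Matrix.diag_apply, truncation_pow_apply_self]

theorem norm_meanTrace_le (K : Finset V) (T : ℓ²(V, ℂ) →L[ℂ] ℓ²(V, ℂ)) :
    ‖meanTrace K T‖ ≤ ‖T‖ := by
  rw [meanTrace, norm_div, Complex.norm_natCast]
  refine div_le_of_le_mul₀ (by positivity) (norm_nonneg _) ?_
  refine (norm_sum_le _ _).trans ((Finset.sum_le_sum fun v _ => norm_inner_delta_le v T).trans ?_)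
  rw [Finset.sum_const, nsmul_eq_mul, mul_comm]

theorem meanTrace_add (K : Finset V) (S T : ℓ²(V, ℂ) →L[ℂ] ℓ²(V, ℂ)) :
    meanTrace K (S + T) = meanTrace K S + meanTrace K T := by
  simp [meanTrace, Finset.sum_add_distrib, add_div]

theorem meanTrace_sub (K : Finset V) (S T : ℓ²(V, ℂ) →L[ℂ] ℓ²(V, ℂ)) :
    meanTrace K (S - T) = meanTrace K S - meanTrace K T := by
  simp [meanTrace, Finset.sum_sub_distrib, sub_div]

theorem meanTrace_smul (K : Finset V) (c : ℂ) (T : ℓ²(V, ℂ) →L[ℂ] ℓ²(V, ℂ)) :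
    meanTrace K (c • T) = c * meanTrace K T := by
  simp [meanTrace, ← Finset.mul_sum, mul_div_assoc]

/-! ### The Laplacian on basis vectors -/

section Laplacian

variable (G : SimpleGraph V) [G.LocallyFinite] (hG : BoundedDegree G)

theorem laplacian_delta (v : V) :
    laplacian G hG (delta v) =
      (G.degree v : ℂ) • delta v - ∑ w ∈ G.neighborFinset v, delta w := by
  rw [laplacian, sub_apply, adjacency_delta]
  congr 1
  classical
  apply lp.ext
  funext u
  rw [degreeOperator_apply, lp.coeFn_smul, Pi.smul_apply, smul_eq_mul, delta_apply]
  split_ifs with h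
  · rw [h]
  · simp

theorem neighborFinset_eq_of_neighborSet_eq {X Y : SimpleGraph V} [X.LocallyFinite]
    [Y.LocallyFinite] {v : V} (h : X.neighborSet v = Y.neighborSet v) :
    X.neighborFinset v = Y.neighborFinset v := by
  ext w
  rw [SimpleGraph.mem_neighborFinset, SimpleGraph.mem_neighborFinset,
    ← SimpleGraph.mem_neighborSet, h, SimpleGraph.mem_neighborSet]

theorem laplacian_delta_eq_of_neighborSet_eq {X Y : SimpleGraph V} [X.LocallyFinite]
    [Y.LocallyFinite] (hX : BoundedDegree X) (hY : BoundedDegree Y) {v : V}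
    (h : X.neighborSet v = Y.neighborSet v) :
    laplacian Y hY (delta v) = laplacian X hX (delta v) := by
  have h' := neighborFinset_eq_of_neighborSet_eq h
  rw [laplacian_delta, laplacian_delta, ← SimpleGraph.card_neighborFinset_eq_degree,
    ← SimpleGraph.card_neighborFinset_eq_degree, h']

end Laplacian

/-! ### Density zero perturbations change few neighbourhoods -/

/-- With `R = √S`, one has `‖S x‖ ≤ ‖R‖ ‖R x‖`, `‖R x‖² = ⟪x, S x⟫` and `‖R‖² = ‖S‖`. -/
theorem norm_apply_sq_le_of_isPositive {E : Type*} [NormedAddCommGroup E]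
    [InnerProductSpace ℂ E] [CompleteSpace E] {S : E →L[ℂ] E} (hS : S.IsPositive) (x : E) :
    ‖S x‖ ^ 2 ≤ ‖S‖ * ‖⟪x, S x⟫_ℂ‖ := by
  have h0 : 0 ≤ S := (ContinuousLinearMap.nonneg_iff_isPositive S).2 hS
  set R := CFC.sqrt S with hR
  have hRR : R * R = S := CFC.sqrt_mul_sqrt_self S
  have hRs : IsSelfAdjoint R := (CFC.sqrt_nonneg S).isSelfAdjoint
  have h1 : ⟪x, S x⟫_ℂ = ⟪R x, R x⟫_ℂ := by
    rw [← hRR, mul_apply_eq_comp]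
    exact (hRs.isSymmetric x (R x)).symm
  have h2 : ‖S‖ = ‖R‖ * ‖R‖ := by
    rw [← sq, ← hRs.norm_mul_self, hRR]
  have h3 : ‖S x‖ ≤ ‖R‖ * ‖R x‖ := by
    rw [← hRR, mul_apply_eq_comp]
    exact R.le_opNorm _
  rw [h1, inner_self_eq_norm_sq_to_K, h2]
  have h4 : ‖((‖R x‖ : ℂ)) ^ 2‖ = ‖R x‖ ^ 2 := by simp
  calc ‖S x‖ ^ 2 ≤ (‖R‖ * ‖R x‖) ^ 2 := by gcongr
    _ = ‖R‖ * ‖R‖ * ‖R x‖ ^ 2 := by ring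
    _ = _ := by rw [← h4]; rfl

/-- The mean of `‖T δ_v‖ ^ 2` over the vertices of `K`. -/
def meanNormSq (K : Finset V) (T : ℓ²(V, ℂ) →L[ℂ] ℓ²(V, ℂ)) : ℝ :=
  (∑ v ∈ K, ‖T (delta v)‖ ^ 2) / (K.card : ℝ)

theorem meanNormSq_nonneg (K : Finset V) (T : ℓ²(V, ℂ) →L[ℂ] ℓ²(V, ℂ)) :
    0 ≤ meanNormSq K T := by
  unfold meanNormSq
  positivity

theorem meanNormSq_le_of_isPositive (K : Finset V) {S : ℓ²(V, ℂ) →L[ℂ] ℓ²(V, ℂ)}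
    (hS : S.IsPositive) : meanNormSq K S ≤ ‖S‖ * ‖meanTrace K S‖ := by
  rw [meanTrace, norm_div, Complex.norm_natCast, ← mul_div_assoc, meanNormSq]
  refine div_le_div_of_nonneg_right ?_ (Nat.cast_nonneg _)
  have h2 : ∀ v, ⟪delta v, S (delta v)⟫_ℂ = ((‖⟪delta v, S (delta v)⟫_ℂ‖ : ℝ) : ℂ) := fun v =>
    Complex.eq_coe_norm_of_nonneg (hS.inner_nonneg_right _)
  rw [Finset.sum_congr rfl fun v _ => h2 v, ← Complex.ofReal_sum, Complex.norm_real,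
    Real.norm_of_nonneg (Finset.sum_nonneg fun v _ => norm_nonneg _), Finset.mul_sum]
  exact Finset.sum_le_sum fun v _ => norm_apply_sq_le_of_isPositive hS _

theorem meanNormSq_add_le (K : Finset V) (S R : ℓ²(V, ℂ) →L[ℂ] ℓ²(V, ℂ)) :
    meanNormSq K (S + R) ≤ 2 * (meanNormSq K S + meanNormSq K R) := by
  unfold meanNormSq
  rw [← add_div, ← mul_div_assoc, ← Finset.sum_add_distrib, Finset.mul_sum]
  refine div_le_div_of_nonneg_right (Finset.sum_le_sum fun v _ => ?_) (Nat.cast_nonneg _)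
  rw [add_apply]
  exact (pow_le_pow_left₀ (norm_nonneg _) (norm_add_le _ _) 2).trans add_sq_le

theorem meanNormSq_smul (K : Finset V) (c : ℂ) (S : ℓ²(V, ℂ) →L[ℂ] ℓ²(V, ℂ)) :
    meanNormSq K (c • S) = ‖c‖ ^ 2 * meanNormSq K S := by
  unfold meanNormSq
  rw [← mul_div_assoc, Finset.mul_sum]
  simp [norm_smul, mul_pow]

/-- The trace itself carries no information about `A_X - A_Y`, whose diagonal vanishes. The mean
square norm does: it is controlled by the trace on positive operators, and its convergence to zero
survives linear combinations. -/
theorem IsEssentiallyZero.tendsto_meanNormSq {K : ℕ → Finset V}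
    {T : ℓ²(V, ℂ) →L[ℂ] ℓ²(V, ℂ)} (hT : IsEssentiallyZero K T) :
    Tendsto (fun n => meanNormSq (K n) T) atTop (𝓝 0) := by
  unfold IsEssentiallyZero at hT
  induction hT using Submodule.span_induction with
  | mem S hS =>
    refine squeeze_zero (fun n => meanNormSq_nonneg _ _)
      (fun n => meanNormSq_le_of_isPositive (K n) hS.1) ?_
    simpa using hS.2.norm.const_mul ‖S‖
  | zero => simp [meanNormSq]
  | add S R _ _ hS hR =>
    refine squeeze_zero (fun n => meanNormSq_nonneg _ _) (fun n => meanNormSq_add_le _ _ _) ?_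
    simpa using (hS.add hR).const_mul 2
  | smul c S _ hS =>
    simp only [meanNormSq_smul]
    simpa using hS.const_mul (‖c‖ ^ 2)

open scoped Classical in
theorem IsDensityZeroPerturbation.tendsto_card_neighborSet_ne {K : ℕ → Finset V}
    {X Y : SimpleGraph V} [X.LocallyFinite] [Y.LocallyFinite] {hX : BoundedDegree X}
    {hY : BoundedDegree Y} (h : IsDensityZeroPerturbation K X Y hX hY) :
    Tendsto (fun n => (((K n).filter fun v => X.neighborSet v ≠ Y.neighborSet v).card : ℝ) /
      ((K n).card : ℝ)) atTop (𝓝 0) := by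
  refine squeeze_zero (fun n => by positivity) (fun n => ?_) (IsEssentiallyZero.tendsto_meanNormSq h)
  refine div_le_div_of_nonneg_right ?_ (Nat.cast_nonneg _)
  rw [Finset.card_eq_sum_ones, Nat.cast_sum, Finset.sum_filter]
  refine Finset.sum_le_sum fun v _ => ?_
  split_ifs with hv
  -- An edge `vw` present in only one graph gives an entry `±1` in the column of `v`.
  · obtain ⟨w, hw⟩ : ∃ w, ¬ (X.Adj v w ↔ Y.Adj v w) := by
      by_contra! hcon
      exact hv (Set.ext hcon)
    have h1 := lp.norm_apply_le_norm (p := 2) (by simp)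
      ((adjacency X hX - adjacency Y hY) (delta v)) w
    have h2 : ((adjacency X hX - adjacency Y hY) (delta v)) w =
        (if X.Adj v w then 1 else 0) - (if Y.Adj v w then 1 else 0) := by
      rw [sub_apply, lp.coeFn_sub, Pi.sub_apply, adjacency_apply,
        adjacency_apply]
      simp [delta_apply, SimpleGraph.adj_comm]
    rw [h2] at h1
    have h3 : (1 : ℝ) ≤ ‖(adjacency X hX - adjacency Y hY) (delta v)‖ := by
      refine le_trans (le_of_eq ?_) h1
      by_cases hx : X.Adj v w <;> by_cases hy : Y.Adj v w <;> simp_all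
    rw [Nat.cast_one]
    exact one_le_pow₀ h3
  · positivity

/-! ### Vertices whose neighbourhoods of a given radius are unperturbed -/

open scoped Classical in
/-- The vertices of `K` from which all paths of length at most `k` in `X` stay in `K`, and meet
the exceptional set `B` at most in their last vertex. -/
def good (X : SimpleGraph V) (B : Set V) (K : Finset V) : ℕ → Finset V
  | 0 => K
  | k + 1 => (good X B K k).filter fun v => v ∉ B ∧ ∀ w, X.Adj v w → w ∈ good X B K k

section Good

variable {X : SimpleGraph V} {B : Set V} {K : Finset V}

theorem good_zero : good X B K 0 = K := by
  simp only [good]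

theorem mem_good_succ {k : ℕ} {v : V} :
    v ∈ good X B K (k + 1) ↔
      v ∈ good X B K k ∧ v ∉ B ∧ ∀ w, X.Adj v w → w ∈ good X B K k := by
  classical
  simp [good]

theorem good_antitone : Antitone (good X B K) :=
  antitone_nat_of_succ_le fun _ _ hv => (mem_good_succ.1 hv).1

theorem good_subset (k : ℕ) : good X B K k ⊆ K := good_antitone (Nat.zero_le k)

-- A vertex fails at level `k + 1` if it failed at level `k`, lies in `B`, lies on the boundary, or
-- is a neighbour of a vertex of `K` that failed at level `k`. Each failed vertex has at most `d`
-- neighbours.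
open scoped Classical in
theorem card_sdiff_good_succ_le [X.LocallyFinite] {d : ℕ} (hd : ∀ v, X.degree v ≤ d) (k : ℕ) :
    (K \ good X B K (k + 1)).card ≤ (d + 1) * (K \ good X B K k).card +
      (K.filter (· ∈ B)).card + (boundary X K).card := by
  have hsub : K \ good X B K (k + 1) ⊆ (K \ good X B K k) ∪ (K.filter (· ∈ B)) ∪ boundary X K ∪
      (K \ good X B K k).biUnion fun w => X.neighborFinset w := by
    intro v hv
    rw [Finset.mem_sdiff, mem_good_succ] at hv
    obtain ⟨hvK, hv⟩ := hv
    simp only [Finset.mem_union, Finset.mem_sdiff, Finset.mem_filter, boundary,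
      Finset.mem_biUnion, SimpleGraph.mem_neighborFinset]
    by_contra! hcon
    obtain ⟨⟨⟨h1, h2⟩, h3⟩, h4⟩ := hcon
    refine hv ⟨h1 hvK, h2 hvK, fun w hw => ?_⟩
    by_contra hwg
    refine h4 w ⟨?_, hwg⟩ hw.symm
    by_contra hwK
    exact h3 hvK w hwK hw
  have h1 := Finset.card_le_card hsub
  have h2 : ((K \ good X B K k).biUnion fun w => X.neighborFinset w).card ≤
      (K \ good X B K k).card * d :=
    Finset.card_biUnion_le_card_mul _ _ _ fun w _ => by simpa using hd w
  have h3 := Finset.card_union_le ((K \ good X B K k) ∪ (K.filter (· ∈ B)) ∪ boundary X K)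
    ((K \ good X B K k).biUnion fun w => X.neighborFinset w)
  have h4 := Finset.card_union_le ((K \ good X B K k) ∪ (K.filter (· ∈ B))) (boundary X K)
  have h5 := Finset.card_union_le (K \ good X B K k) (K.filter (· ∈ B))
  linarith

end Good

open scoped Classical in
theorem tendsto_card_sdiff_good {X : SimpleGraph V} [X.LocallyFinite] (hX : BoundedDegree X)
    {B : Set V} {K : ℕ → Finset V} (hK : IsAmenableExhaustion X K)
    (hB : Tendsto (fun n => (((K n).filter (· ∈ B)).card : ℝ) / ((K n).card : ℝ)) atTop (𝓝 0))
    (k : ℕ) :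
    Tendsto (fun n => ((K n \ good X B (K n) k).card : ℝ) / ((K n).card : ℝ)) atTop (𝓝 0) := by
  obtain ⟨d, hd⟩ := hX
  induction k with
  | zero => simp [good]
  | succ k ih =>
    have h := ((ih.const_mul ((d : ℝ) + 1)).add hB).add hK.boundary_ratio
    simp only [mul_zero, add_zero] at h
    refine squeeze_zero (fun n => by positivity) (fun n => ?_) h
    rw [← mul_div_assoc, ← add_div, ← add_div]
    refine div_le_div_of_nonneg_right ?_ (Nat.cast_nonneg _)
    exact_mod_cast card_sdiff_good_succ_le hd k

theorem laplacian_delta_mem_span {X : SimpleGraph V} [X.LocallyFinite] (hX : BoundedDegree X)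
    {B : Set V} {K : Finset V} {k : ℕ} {v : V} (hv : v ∈ good X B K (k + 1)) :
    laplacian X hX (delta v) ∈ Submodule.span ℂ (delta '' (good X B K k : Set V)) := by
  rw [mem_good_succ] at hv
  rw [laplacian_delta]
  refine Submodule.sub_mem _ (Submodule.smul_mem _ _ (Submodule.subset_span ⟨v, hv.1, rfl⟩))
    (Submodule.sum_mem _ fun w hw => Submodule.subset_span ⟨w, hv.2.2 w ?_, rfl⟩)
  simpa using hw

/-- Each application of the Laplacian uses up one unit of the radius `k`. Spans are needed because
`Δ_X δ_v` is no longer a basis vector. The operator `A` stands for both `Δ_Y` and its compression.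
-/
theorem pow_apply_eq_of_mem_span_good {X : SimpleGraph V} [X.LocallyFinite]
    (hX : BoundedDegree X) {B : Set V} {K : Finset V} {A : ℓ²(V, ℂ) →L[ℂ] ℓ²(V, ℂ)}
    (hA : ∀ v ∈ good X B K 1, A (delta v) = laplacian X hX (delta v)) (k : ℕ)
    {f : ℓ²(V, ℂ)} (hf : f ∈ Submodule.span ℂ (delta '' (good X B K k : Set V))) :
    (A ^ k) f = (laplacian X hX ^ k) f := by
  induction k generalizing f with
  | zero => simp
  | succ k ih =>
    have h : A f = laplacian X hX f ∧
        laplacian X hX f ∈ Submodule.span ℂ (delta '' (good X B K k : Set V)) := by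
      induction hf using Submodule.span_induction with
      | mem f hf =>
        obtain ⟨v, hv, rfl⟩ := hf
        exact ⟨hA v (good_antitone (Nat.le_add_left 1 k) hv), laplacian_delta_mem_span hX hv⟩
      | zero => simp
      | add f g _ _ hf hg =>
        rw [map_add, map_add, hf.1, hg.1]
        exact ⟨rfl, Submodule.add_mem _ hf.2 hg.2⟩
      | smul c f _ hf =>
        rw [map_smul, map_smul, hf.1]
        exact ⟨rfl, Submodule.smul_mem _ c hf.2⟩
    rw [pow_succ, pow_succ, mul_apply_eq_comp, mul_apply_eq_comp, h.1, ih h.2]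

theorem tendsto_meanTrace_pow_sub {X : SimpleGraph V} [X.LocallyFinite]
    (hX : BoundedDegree X) {B : Set V} {K : ℕ → Finset V} (hK : IsAmenableExhaustion X K)
    (hB : Tendsto (fun n => ((open scoped Classical in (K n).filter (· ∈ B)).card : ℝ) /
      ((K n).card : ℝ)) atTop (𝓝 0))
    {A : ℕ → ℓ²(V, ℂ) →L[ℂ] ℓ²(V, ℂ)} {M : ℝ} (hM : ∀ n, ‖A n‖ ≤ M)
    (hA : ∀ n, ∀ v ∈ good X B (K n) 1, A n (delta v) = laplacian X hX (delta v)) (k : ℕ) :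
    Tendsto (fun n => meanTrace (K n) (A n ^ k) - meanTrace (K n) (laplacian X hX ^ k))
      atTop (𝓝 0) := by
  classical
  have hM0 : 0 ≤ M := (norm_nonneg _).trans (hM 0)
  have h := (tendsto_card_sdiff_good hX hK hB k).const_mul (M ^ k + ‖laplacian X hX ^ k‖)
  rw [mul_zero] at h
  refine squeeze_zero_norm (fun n => ?_) h
  rw [← meanTrace_sub, meanTrace, norm_div, Complex.norm_natCast, ← mul_div_assoc]
  refine div_le_div_of_nonneg_right ?_ (Nat.cast_nonneg _)
  have h0 : ∀ v ∈ good X B (K n) k,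
      ⟪delta v, (A n ^ k - laplacian X hX ^ k) (delta v)⟫_ℂ = 0 := fun v hv => by
    rw [sub_apply, pow_apply_eq_of_mem_span_good hX (hA n) k
      (Submodule.subset_span ⟨v, hv, rfl⟩), sub_self, inner_zero_right]
  -- Only the vertices outside `good` remain, each contributing at most `M ^ k + ‖Δ_X ^ k‖`.
  rw [← Finset.sum_sdiff (good_subset (X := X) (B := B) k), Finset.sum_eq_zero h0, add_zero,
    mul_comm, ← nsmul_eq_mul]
  refine (norm_sum_le _ _).trans (Finset.sum_le_card_nsmul _ _ _ fun v _ => ?_)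
  refine (norm_inner_delta_le v _).trans ((norm_sub_le _ _).trans ?_)
  gcongr
  by_cases hk : k = 0
  · subst hk
    rw [pow_zero, pow_zero]
    exact ContinuousLinearMap.norm_id_le
  · exact (norm_pow_le' _ (Nat.pos_of_ne_zero hk)).trans
      (pow_le_pow_left₀ (norm_nonneg _) (hM n) k)

/-! ### Means of invariant functions -/

section Orbits

variable {X : SimpleGraph V} {Γ : Subgroup (X ≃g X)}

open scoped Classical in
/-- The vertices of `K` in the `Γ`-orbit of `x`. -/
def orbitPart (Γ : Subgroup (X ≃g X)) (K : Finset V) (x : V) : Finset V :=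
  K.filter fun v => ∃ γ ∈ Γ, γ x = v

theorem mem_orbitPart {K : Finset V} {x v : V} :
    v ∈ orbitPart Γ K x ↔ v ∈ K ∧ ∃ γ ∈ Γ, γ x = v := by
  classical
  simp [orbitPart]

/-- Away from the boundary, `γ x ↦ γ y` maps one orbit part into the other, and it is injective
because the action is free. -/
theorem card_orbitPart_le (hfree : ∀ γ ∈ Γ, ∀ v : V, γ v = v → γ = 1) {K : Finset V} {x y : V}
    (h : ∀ v ∈ K, v ∉ boundary X K → (∃ γ ∈ Γ, γ x = v) → ∃ γ ∈ Γ, γ x = v ∧ γ y ∈ K) :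
    (orbitPart Γ K x).card ≤ (orbitPart Γ K y).card + (boundary X K).card := by
  classical
  have hv : ∀ v ∈ orbitPart Γ K x \ boundary X K, ∃ γ ∈ Γ, γ x = v ∧ γ y ∈ K := fun v hv => by
    rw [Finset.mem_sdiff, mem_orbitPart] at hv
    exact h v hv.1.1 hv.2 hv.1.2
  choose! g hgΓ hgx hgy using hv
  have h1 : (orbitPart Γ K x \ boundary X K).card ≤ (orbitPart Γ K y).card := by
    refine Finset.card_le_card_of_injOn (fun v => g v y)
      (fun v hv => mem_orbitPart.2 ⟨hgy v hv, g v, hgΓ v hv, rfl⟩) ?_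
    intro v hv w hw hvw
    have h2 : (g w)⁻¹ * g v = 1 := by
      refine hfree _ (Γ.mul_mem (Γ.inv_mem (hgΓ w hw)) (hgΓ v hv)) y ?_
      change (g w).symm (g v y) = y
      rw [show g v y = g w y from hvw]
      exact (g w).symm_apply_apply y
    have h3 : g v = g w := (inv_mul_eq_one.1 h2).symm
    rw [← hgx v hv, ← hgx w hw, h3]
  have h2 := Finset.le_card_sdiff (boundary X K) (orbitPart Γ K x)
  omega

theorem tendsto_card_orbitPart_sub (hfree : ∀ γ ∈ Γ, ∀ v : V, γ v = v → γ = 1)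
    {K : ℕ → Finset V} (hK : IsAmenableExhaustion X K) {x y : V}
    (hxy : ∀ n, ∀ v ∈ K n, v ∉ boundary X (K n) → (∃ γ ∈ Γ, γ x = v) →
      ∃ γ ∈ Γ, γ x = v ∧ γ y ∈ K n)
    (hyx : ∀ n, ∀ v ∈ K n, v ∉ boundary X (K n) → (∃ γ ∈ Γ, γ y = v) →
      ∃ γ ∈ Γ, γ y = v ∧ γ x ∈ K n) :
    Tendsto (fun n => (((orbitPart Γ (K n) x).card : ℝ) - (orbitPart Γ (K n) y).card) /
      ((K n).card : ℝ)) atTop (𝓝 0) := by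
  refine squeeze_zero_norm (fun n => ?_) hK.boundary_ratio
  rw [norm_div, Real.norm_natCast]
  refine div_le_div_of_nonneg_right ?_ (Nat.cast_nonneg _)
  have h1 : ((orbitPart Γ (K n) x).card : ℝ) ≤
      (orbitPart Γ (K n) y).card + (boundary X (K n)).card := by
    exact_mod_cast card_orbitPart_le hfree (hxy n)
  have h2 : ((orbitPart Γ (K n) y).card : ℝ) ≤
      (orbitPart Γ (K n) x).card + (boundary X (K n)).card := by
    exact_mod_cast card_orbitPart_le hfree (hyx n)
  rw [Real.norm_eq_abs, abs_le]
  constructor <;> linarith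

theorem mem_of_adj_of_notMem_boundary {K : Finset V} {v w : V} (hv : v ∈ K)
    (hb : v ∉ boundary X K) (h : X.Adj v w) : w ∈ K := by
  classical
  by_contra hw
  exact hb (Finset.mem_filter.2 ⟨hv, w, hw, h⟩)

/-- For adjacent `x` and `y`, if `γ x` is off the boundary then its neighbour `γ y` stays in `K n`.
The general case telescopes along a walk. -/
theorem tendsto_card_orbitPart_sub_of_connected (hX : X.Connected)
    (hfree : ∀ γ ∈ Γ, ∀ v : V, γ v = v → γ = 1) {K : ℕ → Finset V}
    (hK : IsAmenableExhaustion X K) (x y : V) :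
    Tendsto (fun n => (((orbitPart Γ (K n) x).card : ℝ) - (orbitPart Γ (K n) y).card) /
      ((K n).card : ℝ)) atTop (𝓝 0) := by
  obtain ⟨p⟩ := hX.preconnected x y
  induction p with
  | nil => simp
  | cons hadj _ ih =>
    have h := (tendsto_card_orbitPart_sub hfree hK
      (fun n v hv hb ⟨γ, hγ, hv'⟩ => ⟨γ, hγ, hv',
        mem_of_adj_of_notMem_boundary hv hb (hv' ▸ γ.map_adj_iff.2 hadj)⟩)
      (fun n v hv hb ⟨γ, hγ, hv'⟩ => ⟨γ, hγ, hv',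
        mem_of_adj_of_notMem_boundary hv hb (hv' ▸ γ.map_adj_iff.2 hadj.symm)⟩)).add ih
    rw [add_zero] at h
    refine h.congr fun n => ?_
    rw [← add_div, sub_add_sub_cancel]

theorem exists_isFundamentalDomain_tendsto (hΓ : IsPeriodic X Γ) {K : ℕ → Finset V}
    (hK : IsAmenableExhaustion X K) (hKΓ : X.Connected ∨ IsTiledExhaustion Γ K) :
    ∃ F : Finset V, IsFundamentalDomain Γ F ∧ ∀ x ∈ F, ∀ y ∈ F,
      Tendsto (fun n => (((orbitPart Γ (K n) x).card : ℝ) - (orbitPart Γ (K n) y).card) /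
        ((K n).card : ℝ)) atTop (𝓝 0) := by
  rcases hKΓ with hc | ⟨F, hF, E, hEΓ, hEK, hKE⟩
  · obtain ⟨F, hF⟩ := hΓ.cofinite
    exact ⟨F, hF, fun x _ y _ => tendsto_card_orbitPart_sub_of_connected hc hΓ.free hK x y⟩
  · refine ⟨F, hF, ?_⟩
    have key : ∀ x ∈ F, ∀ y ∈ F, ∀ n, ∀ v ∈ K n, v ∉ boundary X (K n) →
        (∃ γ ∈ Γ, γ x = v) → ∃ γ ∈ Γ, γ x = v ∧ γ y ∈ K n := by
      intro x hx y hy n v hv hb hxv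
      obtain ⟨γ, hγ, z, hz, hzv⟩ := hKE n v hv hb
      -- The tile `γ F` covering `v` meets it in the translate of `x`, and it lies in `K n`, so it
      -- supplies `γ y` as well.
      have hzx : z = x := (hF v).unique ⟨hz, γ, hEΓ n hγ, hzv⟩ ⟨hx, hxv⟩
      exact ⟨γ, hEΓ n hγ, hzx ▸ hzv, hEK n γ hγ y hy⟩
    exact fun x hx y hy => tendsto_card_orbitPart_sub hΓ.free hK (key x hx y hy) (key y hy x hx)

theorem sum_eq_sum_card_orbitPart_mul {F : Finset V} (hF : IsFundamentalDomain Γ F) {t : V → ℂ}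
    (ht : ∀ γ ∈ Γ, ∀ v, t (γ v) = t v) (K : Finset V) :
    ∑ v ∈ K, t v = ∑ x ∈ F, ((orbitPart Γ K x).card : ℂ) * t x := by
  classical
  have h1 : K = F.biUnion (orbitPart Γ K) := by
    ext v
    rw [Finset.mem_biUnion]
    constructor
    · intro hv
      obtain ⟨x, ⟨hx, hxv⟩, _⟩ := hF v
      exact ⟨x, hx, mem_orbitPart.2 ⟨hv, hxv⟩⟩
    · rintro ⟨x, _, hv⟩
      exact (mem_orbitPart.1 hv).1
  have h2 : (F : Set V).PairwiseDisjoint (orbitPart Γ K) := by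
    intro x hx y hy hxy
    refine Finset.disjoint_left.2 fun v hvx hvy => hxy ?_
    exact (hF v).unique ⟨hx, (mem_orbitPart.1 hvx).2⟩ ⟨hy, (mem_orbitPart.1 hvy).2⟩
  conv_lhs => rw [h1]
  rw [Finset.sum_biUnion h2]
  refine Finset.sum_congr rfl fun x _ => ?_
  rw [← nsmul_eq_mul]
  refine Finset.sum_eq_card_nsmul fun v hv => ?_
  obtain ⟨_, γ, hγ, rfl⟩ := mem_orbitPart.1 hv
  exact ht γ hγ x

theorem eventually_card_ne_zero [Nonempty V] {K : ℕ → Finset V}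
    (hK : IsAmenableExhaustion X K) : ∀ᶠ n in atTop, ((K n).card : ℝ) ≠ 0 := by
  obtain ⟨n, hn⟩ := hK.exhausts (Classical.arbitrary V)
  filter_upwards [eventually_ge_atTop n] with m hm
  exact Nat.cast_ne_zero.2 (Finset.card_ne_zero_of_mem (hK.mono hm hn))

theorem IsFundamentalDomain.nonempty [Nonempty V] {F : Finset V}
    (hF : IsFundamentalDomain Γ F) : F.Nonempty := by
  obtain ⟨x, ⟨hx, _⟩, _⟩ := hF (Classical.arbitrary V)
  exact ⟨x, hx⟩

/-- The proportions of the orbits add up to `1` and their differences vanish in the limit, so each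
tends to `1 / |F|`. -/
theorem tendsto_card_orbitPart [Nonempty V] {K : ℕ → Finset V} (hK : IsAmenableExhaustion X K)
    {F : Finset V} (hF : IsFundamentalDomain Γ F)
    (hd : ∀ x ∈ F, ∀ y ∈ F,
      Tendsto (fun n => (((orbitPart Γ (K n) x).card : ℝ) - (orbitPart Γ (K n) y).card) /
        ((K n).card : ℝ)) atTop (𝓝 0)) {x : V} (hx : x ∈ F) :
    Tendsto (fun n => ((orbitPart Γ (K n) x).card : ℝ) / ((K n).card : ℝ)) atTop
      (𝓝 ((F.card : ℝ)⁻¹)) := by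
  have hF0 : (F.card : ℝ) ≠ 0 := Nat.cast_ne_zero.2 hF.nonempty.card_ne_zero
  have h1 := ((tendsto_finsetSum F fun y hy => hd x hx y hy).add_const 1).const_mul
    ((F.card : ℝ)⁻¹)
  simp only [Finset.sum_const_zero, zero_add, mul_one] at h1
  refine h1.congr' ?_
  filter_upwards [eventually_card_ne_zero hK] with n hn
  have h2 : ((K n).card : ℝ) = ∑ y ∈ F, ((orbitPart Γ (K n) y).card : ℝ) := by
    have := sum_eq_sum_card_orbitPart_mul hF (t := fun _ => 1) (fun _ _ _ => rfl) (K n)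
    simp only [Finset.sum_const, nsmul_eq_mul, mul_one] at this
    exact_mod_cast this
  rw [← Finset.sum_div, Finset.sum_sub_distrib, ← h2, Finset.sum_const, nsmul_eq_mul]
  field_simp
  ring

theorem tendsto_mean_of_invariant [Nonempty V] {K : ℕ → Finset V}
    (hK : IsAmenableExhaustion X K) {F : Finset V} (hF : IsFundamentalDomain Γ F)
    (hd : ∀ x ∈ F, ∀ y ∈ F,
      Tendsto (fun n => (((orbitPart Γ (K n) x).card : ℝ) - (orbitPart Γ (K n) y).card) /
        ((K n).card : ℝ)) atTop (𝓝 0)) {t : V → ℂ} (ht : ∀ γ ∈ Γ, ∀ v, t (γ v) = t v) :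
    Tendsto (fun n => (∑ v ∈ K n, t v) / ((K n).card : ℂ)) atTop
      (𝓝 ((∑ x ∈ F, t x) / (F.card : ℂ))) := by
  have h : Tendsto (fun n => ∑ x ∈ F,
      (((((orbitPart Γ (K n) x).card : ℝ) / ((K n).card : ℝ) : ℝ) : ℂ) * t x)) atTop
      (𝓝 (∑ x ∈ F, ((((F.card : ℝ)⁻¹ : ℝ) : ℂ) * t x))) :=
    tendsto_finsetSum F fun x hx =>
      ((Complex.continuous_ofReal.tendsto _).comp (tendsto_card_orbitPart hK hF hd hx)).mul_const _
  convert h using 2 with n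
  · rw [sum_eq_sum_card_orbitPart_mul hF ht, Finset.sum_div]
    refine Finset.sum_congr rfl fun x _ => ?_
    push_cast
    ring
  · rw [← Finset.mul_sum]
    push_cast
    rw [div_eq_inv_mul]

end Orbits

/-! ### Invariance of the functional calculus of a periodic Laplacian -/

section Invariance

variable {X : SimpleGraph V} [X.LocallyFinite] (hX : BoundedDegree X)

/-- Relating two vectors pointwise expresses commutation with `γ` without introducing the
translation operator on `ℓ²(V)`. -/
theorem laplacian_apply_equiv (γ : X ≃g X) {f g : ℓ²(V, ℂ)} (h : ∀ w, g (γ w) = f w) (w : V) :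
    laplacian X hX g (γ w) = laplacian X hX f w := by
  rw [laplacian_apply, laplacian_apply]
  refine (Finset.sum_bij (fun u _ => γ u) (fun u hu => ?_) (fun u _ u' _ huu => γ.injective huu)
    (fun u hu => ⟨γ.symm u, ?_, γ.apply_symm_apply u⟩) fun u _ => ?_).symm
  · rw [SimpleGraph.mem_neighborFinset] at hu ⊢
    exact γ.map_adj_iff.2 hu
  · rw [SimpleGraph.mem_neighborFinset] at hu ⊢
    rw [← γ.map_adj_iff]
    simpa using hu
  · rw [h, h]

theorem laplacian_pow_apply_equiv (γ : X ≃g X) (k : ℕ) {f g : ℓ²(V, ℂ)}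
    (h : ∀ w, g (γ w) = f w) (w : V) :
    (laplacian X hX ^ k) g (γ w) = (laplacian X hX ^ k) f w := by
  induction k generalizing f g with
  | zero => simpa using h w
  | succ k ih =>
    rw [pow_succ, mul_apply_eq_comp, mul_apply_eq_comp]
    exact ih fun w => laplacian_apply_equiv hX γ h w

theorem inner_laplacian_pow_equiv (γ : X ≃g X) (k : ℕ) (v : V) :
    ⟪delta (γ v), (laplacian X hX ^ k) (delta (γ v))⟫_ℂ =
      ⟪delta v, (laplacian X hX ^ k) (delta v)⟫_ℂ := by
  classical
  rw [inner_delta, inner_delta]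
  exact laplacian_pow_apply_equiv hX γ k (fun w => by simp [delta_apply]) v

end Invariance

/-! ### Convergence of moments implies convergence on continuous functions -/

/-- A functional on functions of a real variable that is bounded by the supremum over `[-M, M]` on
continuous functions, and linear on polynomials. -/
structure IsMomentFunctional (M : ℝ) (L : (ℝ → ℝ) → ℂ) : Prop where
  norm_sub_le : ∀ {f g : ℝ → ℝ} {ε : ℝ}, 0 ≤ ε → Continuous f → Continuous g →
    (∀ t ∈ Set.Icc (-M) M, |f t - g t| ≤ ε) → ‖L f - L g‖ ≤ ε
  eval : ∀ p : Polynomial ℝ, L (fun t => p.eval t) =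
    ∑ i ∈ Finset.range (p.natDegree + 1), (p.coeff i : ℂ) * L (fun t => t ^ i)

/-- Weierstrass approximation on the interval `[-M, M]`, which serves all the functionals at once.
Two approximation errors and one polynomial error, of `ε / 4` each, stay below `ε`. -/
theorem IsMomentFunctional.tendsto {M : ℝ} {L : ℕ → (ℝ → ℝ) → ℂ} {L' : (ℝ → ℝ) → ℂ}
    (hL : ∀ n, IsMomentFunctional M (L n)) (hL' : IsMomentFunctional M L')
    (hmom : ∀ k : ℕ, Tendsto (fun n => L n (fun t => t ^ k)) atTop (𝓝 (L' (fun t => t ^ k))))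
    {φ : ℝ → ℝ} (hφ : Continuous φ) : Tendsto (fun n => L n φ) atTop (𝓝 (L' φ)) := by
  rw [Metric.tendsto_atTop]
  intro ε hε
  obtain ⟨p, hp⟩ := exists_polynomial_near_of_continuousOn (-M) M φ hφ.continuousOn (ε / 4)
    (by positivity)
  have hp1 : ∀ t ∈ Set.Icc (-M) M, |φ t - p.eval t| ≤ ε / 4 := fun t ht => by
    rw [abs_sub_comm]
    exact (hp t ht).le
  have hpc : Continuous fun t => p.eval t := p.continuous
  have h1 : Tendsto (fun n => L n (fun t => p.eval t)) atTop (𝓝 (L' (fun t => p.eval t))) := by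
    simp only [(hL _).eval, hL'.eval]
    exact tendsto_finsetSum _ fun i _ => (hmom i).const_mul _
  obtain ⟨N, hN⟩ := Metric.tendsto_atTop.1 h1 (ε / 4) (by positivity)
  refine ⟨N, fun n hn => ?_⟩
  have h2 := (hL n).norm_sub_le (by positivity) hφ hpc hp1
  have h3 := hL'.norm_sub_le (by positivity) hφ hpc hp1
  have h4 := hN n hn
  rw [← dist_eq_norm] at h2 h3
  have h5 := dist_triangle4 (L n φ) (L n fun t => p.eval t) (L' fun t => p.eval t) (L' φ)
  rw [dist_comm (L' fun t => p.eval t)] at h5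
  linarith

/-! ### The continuous functional calculus of a self-adjoint operator -/

section Calculus

variable {E : Type*} [NormedAddCommGroup E] [InnerProductSpace ℂ E] [CompleteSpace E]

/-- The functional calculus `φ(H)` for a function `φ` that need not be bounded. -/
def realCalculus (φ : ℝ → ℝ) (H : E →L[ℂ] E) : E →L[ℂ] E := cfc φ H

variable {H : E →L[ℂ] E} (hH : IsSelfAdjoint H)

theorem spectrum_subset_Icc {M : ℝ} (hM : ‖H‖ ≤ M) : spectrum ℝ H ⊆ Set.Icc (-M) M := by
  intro t ht
  have h1 := spectrum.norm_le_norm_mul_of_mem ht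
  have h2 : ‖(1 : E →L[ℂ] E)‖ ≤ 1 := ContinuousLinearMap.norm_id_le
  rw [Real.norm_eq_abs] at h1
  exact abs_le.1 ((h1.trans (mul_le_of_le_one_right (norm_nonneg _) h2)).trans hM)

include hH in
theorem realCalculus_pow (k : ℕ) : realCalculus (fun t : ℝ => t ^ k) H = H ^ k :=
  cfc_pow_id (R := ℝ) H k hH

include hH in
theorem realCalculus_polynomial (p : Polynomial ℝ) :
    realCalculus (fun t => p.eval t) H =
      ∑ i ∈ Finset.range (p.natDegree + 1), (p.coeff i : ℂ) • H ^ i := by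
  rw [realCalculus, cfc_polynomial p H hH, Polynomial.aeval_eq_sum_range]
  rfl

theorem norm_realCalculus_sub_le {M ε : ℝ} (hM : ‖H‖ ≤ M) (hε : 0 ≤ ε) {f g : ℝ → ℝ}
    (hf : Continuous f) (hg : Continuous g) (h : ∀ t ∈ Set.Icc (-M) M, |f t - g t| ≤ ε) :
    ‖realCalculus f H - realCalculus g H‖ ≤ ε := by
  rw [realCalculus, realCalculus, ← cfc_sub f g H hf.continuousOn hg.continuousOn]
  exact norm_cfc_le hε fun t ht => h t (spectrum_subset_Icc hM ht)

theorem realCalculus_eq_zero {M : ℝ} (hM : ‖H‖ ≤ M) {f : ℝ → ℝ}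
    (h : ∀ t ∈ Set.Icc (-M) M, f t = 0) : realCalculus f H = 0 := by
  rw [realCalculus, cfc_congr (g := fun _ => 0) fun t ht => h t (spectrum_subset_Icc hM ht)]
  exact cfc_const_zero ℝ H

theorem isSelfAdjoint_realCalculus (f : ℝ → ℝ) : IsSelfAdjoint (realCalculus f H) :=
  IsSelfAdjoint.cfc

theorem isPositive_realCalculus {f : ℝ → ℝ} (hf : ∀ t, 0 ≤ f t) :
    (realCalculus f H).IsPositive :=
  (ContinuousLinearMap.nonneg_iff_isPositive _).1 (cfc_nonneg fun t _ => hf t)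

-- Since `e - t ≤ f t` on the spectrum, `e - H ≤ f(H) = 0`.
include hH in
theorem le_re_inner_of_realCalculus_eq_zero {M e : ℝ} (hM : ‖H‖ ≤ M) {f : ℝ → ℝ}
    (hf : Continuous f) (hle : ∀ t ∈ Set.Icc (-M) M, e - t ≤ f t)
    (h0 : realCalculus f H = 0) (x : E) : e * ‖x‖ ^ 2 ≤ (⟪x, H x⟫_ℂ).re := by
  have h1 : cfc (fun t : ℝ => e - t) H ≤ cfc f H :=
    cfc_mono (fun t ht => hle t (spectrum_subset_Icc hM ht)) (by fun_prop) hf.continuousOn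
  have h2 : cfc (fun t : ℝ => e - t) H = algebraMap ℝ _ e - H := by
    rw [cfc_sub (fun _ => e) (fun t => t) H, cfc_const e H, cfc_id' ℝ H]
  have h3 : cfc f H = 0 := h0
  rw [h2, h3, sub_nonpos, ContinuousLinearMap.le_def] at h1
  have h4 := h1.re_inner_nonneg_right x
  have h5 : (H - algebraMap ℝ (E →L[ℂ] E) e) x = H x - (e : ℂ) • x := by
    rw [Algebra.algebraMap_eq_smul_one]
    rfl
  rw [h5, inner_sub_right, inner_smul_right, inner_self_eq_norm_sq_to_K] at h4
  have h6 : (e : ℂ) * ((‖x‖ : ℝ) : ℂ) ^ 2 = ((e * ‖x‖ ^ 2 : ℝ) : ℂ) := by push_cast; rfl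
  change 0 ≤ (⟪x, H x⟫_ℂ - (e : ℂ) * ((‖x‖ : ℝ) : ℂ) ^ 2).re at h4
  rw [h6, Complex.sub_re, Complex.ofReal_re] at h4
  linarith

/-- The positive functional `f ↦ ω(f(H))` on the continuous functions on the spectrum of `H`. -/
def spectralFunctional (ω : (E →L[ℂ] E) →ₗ[ℂ] ℂ) (hω : ∀ T, T.IsPositive → 0 ≤ (ω T).re) :
    C_c(spectrum ℝ H, ℝ) →ₚ[ℝ] ℝ :=
  PositiveLinearMap.mk₀
    { toFun := fun f => (ω (cfcHom hH f.toContinuousMap)).re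
      map_add' := fun f g => by
        rw [← Complex.add_re, ← map_add, ← map_add]
        rfl
      map_smul' := fun c f => by
        rw [show (c • f).toContinuousMap = c • f.toContinuousMap from rfl, map_smul,
          show c • cfcHom hH f.toContinuousMap = (c : ℂ) • cfcHom hH f.toContinuousMap from rfl,
          map_smul, smul_eq_mul, Complex.re_ofReal_mul]
        rfl }
    fun f hf => hω _ <| (ContinuousLinearMap.nonneg_iff_isPositive _).1
      ((cfcHom_nonneg_iff hH).2 hf)

-- The Riesz representation theorem applies on the compact spectrum, where every continuous function
-- is compactly supported. The measure is then pushed forward to `ℝ`, and its mass is `ω 1`.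
include hH in
theorem exists_spectral_probabilityMeasure (ω : (E →L[ℂ] E) →ₗ[ℂ] ℂ)
    (hω : ∀ T, T.IsPositive → 0 ≤ (ω T).re) (hω1 : ω 1 = 1) :
    ∃ N : ProbabilityMeasure ℝ, ∀ φ : ℝ → ℝ, Continuous φ →
      ∫ t, φ t ∂(N : Measure ℝ) = (ω (realCalculus φ H)).re := by
  set μ := RealRMK.rieszMeasure (spectralFunctional hH ω hω) with hμ
  have hint : ∀ φ : ℝ → ℝ, Continuous φ →
      ∫ t, φ t ∂(μ.map Subtype.val) = (ω (realCalculus φ H)).re := by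
    intro φ hφ
    rw [integral_map measurable_subtype_coe.aemeasurable hφ.aestronglyMeasurable]
    let f : C_c(spectrum ℝ H, ℝ) :=
      ⟨⟨fun t => φ t, hφ.comp continuous_subtype_val⟩, HasCompactSupport.of_compactSpace _⟩
    have h := RealRMK.integral_rieszMeasure (spectralFunctional hH ω hω) f
    rw [realCalculus, cfc_apply φ H hH hφ.continuousOn]
    exact h
  have hone : (μ.map (Subtype.val : spectrum ℝ H → ℝ)).real Set.univ = 1 := by
    have h := hint (fun _ => 1) continuous_const
    rw [realCalculus, cfc_const_one ℝ H, hω1, integral_const] at h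
    simpa using h
  have hprob : IsProbabilityMeasure (μ.map (Subtype.val : spectrum ℝ H → ℝ)) :=
    ⟨by rwa [measureReal_def, ENNReal.toReal_eq_one_iff] at hone⟩
  exact ⟨⟨_, hprob⟩, hint⟩

end Calculus

/-! ### The mean trace of the functional calculus -/

/-- The mean trace as a linear functional. -/
def meanTraceLinear (K : Finset V) : (ℓ²(V, ℂ) →L[ℂ] ℓ²(V, ℂ)) →ₗ[ℂ] ℂ where
  toFun := meanTrace K
  map_add' := meanTrace_add K
  map_smul' := meanTrace_smul K

theorem meanTraceLinear_apply (K : Finset V) (T : ℓ²(V, ℂ) →L[ℂ] ℓ²(V, ℂ)) :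
    meanTraceLinear K T = meanTrace K T := rfl

theorem re_meanTrace_nonneg (K : Finset V) {T : ℓ²(V, ℂ) →L[ℂ] ℓ²(V, ℂ)} (hT : T.IsPositive) :
    0 ≤ (meanTrace K T).re := by
  rw [meanTrace, Complex.div_natCast_re, Complex.re_sum]
  exact div_nonneg (Finset.sum_nonneg fun v _ => hT.re_inner_nonneg_right _) (Nat.cast_nonneg _)

theorem im_meanTrace_eq_zero (K : Finset V) {T : ℓ²(V, ℂ) →L[ℂ] ℓ²(V, ℂ)}
    (hT : IsSelfAdjoint T) : (meanTrace K T).im = 0 := by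
  rw [meanTrace, Complex.div_natCast_im, Complex.im_sum, Finset.sum_eq_zero, zero_div]
  intro v _
  rw [← Complex.conj_eq_iff_im, inner_conj_symm]
  exact hT.isSymmetric _ _

theorem meanTrace_one {K : Finset V} (hK : K.Nonempty) : meanTrace K 1 = 1 := by
  have hK0 : (K.card : ℂ) ≠ 0 := Nat.cast_ne_zero.2 hK.card_ne_zero
  simp [meanTrace, inner_self_eq_norm_sq_to_K, norm_delta, hK0]

section MeanTrace

variable {H : ℓ²(V, ℂ) →L[ℂ] ℓ²(V, ℂ)} (hH : IsSelfAdjoint H)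

include hH in
theorem isMomentFunctional_meanTrace (K : Finset V) {M : ℝ} (hM : ‖H‖ ≤ M) :
    IsMomentFunctional M (fun f => meanTrace K (realCalculus f H)) where
  norm_sub_le := by
    intro f g ε hε hf hg hfg
    rw [← meanTrace_sub]
    exact (norm_meanTrace_le _ _).trans (norm_realCalculus_sub_le hM hε hf hg hfg)
  eval := by
    intro p
    rw [realCalculus_polynomial hH, ← meanTraceLinear_apply, map_sum]
    simp only [map_smul, meanTraceLinear_apply, realCalculus_pow hH, smul_eq_mul]

-- Moments determine the functional: the convergence theorem is applied to a constant sequence and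
-- limits are unique.
include hH in
theorem meanTrace_realCalculus_eq {K F : Finset V}
    (hmom : ∀ k : ℕ, meanTrace K (H ^ k) = meanTrace F (H ^ k)) {φ : ℝ → ℝ} (hφ : Continuous φ) :
    meanTrace K (realCalculus φ H) = meanTrace F (realCalculus φ H) := by
  refine tendsto_nhds_unique (tendsto_const_nhds (f := (atTop : Filter ℕ)))
    (IsMomentFunctional.tendsto (fun _ => isMomentFunctional_meanTrace hH K le_rfl)
      (isMomentFunctional_meanTrace hH F le_rfl) (fun k => ?_) hφ)
  simp only [realCalculus_pow hH, hmom]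
  exact tendsto_const_nhds

include hH in
theorem exists_probabilityMeasure_meanTrace {F : Finset V} (hF : F.Nonempty) :
    ∃ N : ProbabilityMeasure ℝ, ∀ φ : ℝ → ℝ, Continuous φ →
      ((∫ t, φ t ∂(N : Measure ℝ) : ℝ) : ℂ) = meanTrace F (realCalculus φ H) := by
  obtain ⟨N, hN⟩ := exists_spectral_probabilityMeasure hH (meanTraceLinear F)
    (fun T hT => re_meanTrace_nonneg F hT) (meanTrace_one hF)
  refine ⟨N, fun φ hφ => Complex.ext (hN φ hφ) ?_⟩
  rw [Complex.ofReal_im, im_meanTrace_eq_zero F (isSelfAdjoint_realCalculus φ)]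

end MeanTrace

/-! ### Eigenvalues of truncations -/

section Eigenvalues

variable {H : ℓ²(V, ℂ) →L[ℂ] ℓ²(V, ℂ)} (hH : IsSelfAdjoint H) (K : Finset V)

open scoped Classical in
theorem integral_eigenvalueMeasure (f : ℝ → ℝ) :
    ∫ t, f t ∂(eigenvalueMeasure K H hH) =
      (∑ i, f ((truncation_isHermitian K hH).eigenvalues i)) / K.card := by
  rw [eigenvalueMeasure, integral_smul_measure,
    integral_finsetSum_measure fun i _ => integrable_dirac (by simp)]
  simp only [integral_dirac, ENNReal.toReal_inv, ENNReal.toReal_natCast, smul_eq_mul]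
  rw [div_eq_inv_mul]

theorem _root_.Matrix.IsHermitian.trace_pow_eq_sum_eigenvalues {n : Type*} [Fintype n]
    [DecidableEq n] {A : Matrix n n ℂ} (hA : A.IsHermitian) (k : ℕ) :
    (A ^ k).trace = ∑ i, (hA.eigenvalues i : ℂ) ^ k := by
  conv_lhs => rw [hA.spectral_theorem, ← map_pow, Unitary.conjStarAlgAut_apply,
    Matrix.trace_mul_cycle, Unitary.coe_star_mul_self, one_mul, Matrix.diagonal_pow,
    Matrix.trace_diagonal]
  rfl

theorem integral_pow_eigenvalueMeasure (k : ℕ) :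
    ((∫ t, t ^ k ∂(eigenvalueMeasure K H hH) : ℝ) : ℂ) = meanTrace K (compression K H ^ k) := by
  classical
  rw [← trace_truncation_pow, (truncation_isHermitian K hH).trace_pow_eq_sum_eigenvalues,
    integral_eigenvalueMeasure]
  push_cast
  rfl

theorem star_dotProduct_truncation_mulVec (x : K → ℂ) :
    star x ⬝ᵥ (truncation K H).mulVec x =
      ⟪∑ v : K, x v • delta (v : V), H (∑ v : K, x v • delta (v : V))⟫_ℂ := by
  simp only [map_sum, map_smul, sum_inner, inner_sum, inner_smul_left, inner_smul_right,
    dotProduct, Matrix.mulVec, truncation, Matrix.of_apply, Pi.star_apply, Finset.mul_sum]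
  rw [Finset.sum_comm]
  refine Finset.sum_congr rfl fun v _ => Finset.sum_congr rfl fun w _ => ?_
  rw [starRingEnd_apply]
  ring

theorem norm_sq_sum_smul_delta (x : K → ℂ) :
    ‖∑ v : K, x v • delta (v : V)‖ ^ 2 = ∑ v, ‖x v‖ ^ 2 := by
  classical
  have h : ⟪∑ v : K, x v • delta (v : V), ∑ v : K, x v • delta (v : V)⟫_ℂ =
      ((∑ v, ‖x v‖ ^ 2 : ℝ) : ℂ) := by
    simp only [sum_inner, inner_sum, inner_smul_left, inner_smul_right, inner_delta, delta_apply,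
      Subtype.coe_inj]
    push_cast
    simp [Complex.mul_conj']
  rw [inner_self_eq_norm_sq_to_K] at h
  refine Complex.ofReal_injective ?_
  rw [Complex.ofReal_pow]
  exact h

-- An eigenvalue of the truncation is a Rayleigh quotient of `H` at a finitely supported unit
-- vector.
open scoped Classical in
theorem abs_eigenvalues_truncation_le (i : K) :
    |(truncation_isHermitian K hH).eigenvalues i| ≤ ‖H‖ := by
  rw [Matrix.IsHermitian.eigenvalues_eq, star_dotProduct_truncation_mulVec]
  have h1 := norm_sq_sum_smul_delta K
    (fun v => (truncation_isHermitian K hH).eigenvectorBasis i v)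
  rw [← EuclideanSpace.norm_sq_eq, (truncation_isHermitian K hH).eigenvectorBasis.norm_eq_one,
    one_pow, pow_eq_one_iff_of_nonneg (norm_nonneg _) two_ne_zero] at h1
  refine (Complex.abs_re_le_norm _).trans ((norm_inner_le_norm _ _).trans ?_)
  have h2 := H.le_opNorm (∑ v : K, ((truncation_isHermitian K hH).eigenvectorBasis i v) •
    delta (v : V))
  rw [h1, mul_one] at h2
  rw [h1, one_mul]
  exact h2

theorem isMomentFunctional_eigenvalueMeasure {M : ℝ} (hM : ‖H‖ ≤ M) :
    IsMomentFunctional M (fun f => ((∫ t, f t ∂(eigenvalueMeasure K H hH) : ℝ) : ℂ)) where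
  norm_sub_le := by
    intro f g ε hε _ _ hfg
    classical
    rw [integral_eigenvalueMeasure, integral_eigenvalueMeasure, ← Complex.ofReal_sub,
      Complex.norm_real, ← sub_div, ← Finset.sum_sub_distrib, norm_div, Real.norm_natCast]
    refine div_le_of_le_mul₀ (Nat.cast_nonneg _) hε ((norm_sum_le _ _).trans ?_)
    refine (Finset.sum_le_card_nsmul _ _ ε fun i _ =>
      hfg _ (abs_le.1 ((abs_eigenvalues_truncation_le hH K i).trans hM))).trans ?_
    simp [mul_comm]
  eval := by
    intro p
    classical
    simp only [integral_eigenvalueMeasure, Polynomial.eval_eq_sum_range]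
    rw [Finset.sum_comm, Finset.sum_div]
    push_cast
    refine Finset.sum_congr rfl fun i _ => ?_
    rw [← Finset.mul_sum, mul_div_assoc]

end Eigenvalues

/-! ### The density of states of a density zero perturbation -/

theorem coordProj_eq_self_of_mem_span {K : Finset V} {f : ℓ²(V, ℂ)}
    (hf : f ∈ Submodule.span ℂ (delta '' (K : Set V))) : coordProj K f = f := by
  induction hf using Submodule.span_induction with
  | mem f hf =>
    obtain ⟨v, hv, rfl⟩ := hf
    exact coordProj_delta hv
  | zero => simp
  | add f g _ _ hf hg => rw [map_add, hf, hg]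
  | smul c f _ hf => rw [map_smul, hf]

/-- The vertices whose neighbourhoods in `X` and `Y` differ. -/
def perturbed (X Y : SimpleGraph V) : Set V := {v | X.neighborSet v ≠ Y.neighborSet v}

theorem mem_perturbed {X Y : SimpleGraph V} {v : V} :
    v ∈ perturbed X Y ↔ X.neighborSet v ≠ Y.neighborSet v := Iff.rfl

section Periodic

variable {X Y : SimpleGraph V} [X.LocallyFinite] [Y.LocallyFinite] {hX : BoundedDegree X}
  {hY : BoundedDegree Y} {Γ : Subgroup (X ≃g X)} {K : ℕ → Finset V} {F : Finset V}

theorem laplacian_delta_eq_of_mem_good {K : Finset V} {v : V}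
    (hv : v ∈ good X (perturbed X Y) K 1) :
    laplacian Y hY (delta v) = laplacian X hX (delta v) := by
  have h := (mem_good_succ.1 hv).2.1
  rw [mem_perturbed, not_not] at h
  exact laplacian_delta_eq_of_neighborSet_eq hX hY h

/-- All `X`-neighbours of such a `v` lie in `K`, so the projection `P_K` cuts nothing off `Δ_X δ_v`.
-/
theorem compression_laplacian_delta_eq_of_mem_good {K : Finset V} {v : V}
    (hv : v ∈ good X (perturbed X Y) K 1) :
    compression K (laplacian Y hY) (delta v) = laplacian X hX (delta v) := by
  rw [compression_delta K _ (good_subset 1 hv), laplacian_delta_eq_of_mem_good (hX := hX) hv]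
  have h := laplacian_delta_mem_span hX (k := 0) hv
  rw [good_zero] at h
  exact coordProj_eq_self_of_mem_span h

/-- Vertex counts of the orbits of any two points of `F` agree asymptotically along `K`. -/
def IsEquidistributed (Γ : Subgroup (X ≃g X)) (K : ℕ → Finset V) (F : Finset V) : Prop :=
  ∀ x ∈ F, ∀ y ∈ F,
    Tendsto (fun n => (((orbitPart Γ (K n) x).card : ℝ) - (orbitPart Γ (K n) y).card) /
      ((K n).card : ℝ)) atTop (𝓝 0)

theorem tendsto_meanTrace_laplacian_pow [Nonempty V] (hK : IsAmenableExhaustion X K)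
    (hF : IsFundamentalDomain Γ F) (hd : IsEquidistributed Γ K F) (k : ℕ) :
    Tendsto (fun n => meanTrace (K n) (laplacian X hX ^ k)) atTop
      (𝓝 (meanTrace F (laplacian X hX ^ k))) :=
  tendsto_mean_of_invariant hK hF hd fun γ _ v => inner_laplacian_pow_equiv hX γ k v

open scoped Classical in
theorem tendsto_card_filter_mem_perturbed (hXY : IsDensityZeroPerturbation K X Y hX hY) :
    Tendsto (fun n => (((K n).filter (· ∈ perturbed X Y)).card : ℝ) / ((K n).card : ℝ)) atTop
      (𝓝 0) := by
  have h := hXY.tendsto_card_neighborSet_ne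
  convert h using 6
  exact mem_perturbed

/-- Used with `A n = Δ_Y` and with `A n` the compression of `Δ_Y` to `K n`; this is why the two
limits defining the density of states coincide. -/
theorem tendsto_meanTrace_pow_of_good [Nonempty V] (hK : IsAmenableExhaustion X K)
    (hF : IsFundamentalDomain Γ F) (hd : IsEquidistributed Γ K F)
    (hXY : IsDensityZeroPerturbation K X Y hX hY)
    {A : ℕ → ℓ²(V, ℂ) →L[ℂ] ℓ²(V, ℂ)} {M : ℝ} (hM : ∀ n, ‖A n‖ ≤ M)
    (hA : ∀ n, ∀ v ∈ good X (perturbed X Y) (K n) 1,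
      A n (delta v) = laplacian X hX (delta v)) (k : ℕ) :
    Tendsto (fun n => meanTrace (K n) (A n ^ k)) atTop
      (𝓝 (meanTrace F (laplacian X hX ^ k))) := by
  have h := (tendsto_meanTrace_pow_sub hX hK (tendsto_card_filter_mem_perturbed hXY) hM hA k).add
    (tendsto_meanTrace_laplacian_pow (hX := hX) hK hF hd k)
  simpa only [sub_add_cancel, zero_add] using h

theorem tendsto_meanTrace_realCalculus [Nonempty V] (hK : IsAmenableExhaustion X K)
    (hF : IsFundamentalDomain Γ F) (hd : IsEquidistributed Γ K F)
    (hXY : IsDensityZeroPerturbation K X Y hX hY) {φ : ℝ → ℝ} (hφ : Continuous φ) :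
    Tendsto (fun n => meanTrace (K n) (realCalculus φ (laplacian Y hY))) atTop
      (𝓝 (meanTrace F (realCalculus φ (laplacian X hX)))) := by
  -- One interval must contain the spectra of both Laplacians.
  refine IsMomentFunctional.tendsto (M := max ‖laplacian X hX‖ ‖laplacian Y hY‖)
    (fun n => isMomentFunctional_meanTrace (laplacian_isSelfAdjoint Y hY) (K n)
      (le_max_right _ _))
    (isMomentFunctional_meanTrace (laplacian_isSelfAdjoint X hX) F (le_max_left _ _))
    (fun k => ?_) hφ
  simp only [realCalculus_pow (laplacian_isSelfAdjoint X hX),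
    realCalculus_pow (laplacian_isSelfAdjoint Y hY)]
  exact tendsto_meanTrace_pow_of_good hK hF hd hXY (fun _ => le_rfl)
    (fun n v hv => laplacian_delta_eq_of_mem_good hv) k

theorem tendsto_integral_eigenvalueMeasure [Nonempty V] (hK : IsAmenableExhaustion X K)
    (hF : IsFundamentalDomain Γ F) (hd : IsEquidistributed Γ K F)
    (hXY : IsDensityZeroPerturbation K X Y hX hY) {φ : ℝ → ℝ} (hφ : Continuous φ) :
    Tendsto (fun n => ((∫ t, φ t ∂(eigenvalueMeasure (K n) (laplacian Y hY)
      (laplacian_isSelfAdjoint Y hY)) : ℝ) : ℂ)) atTop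
      (𝓝 (meanTrace F (realCalculus φ (laplacian X hX)))) := by
  refine IsMomentFunctional.tendsto (M := max ‖laplacian X hX‖ ‖laplacian Y hY‖)
    (fun n => isMomentFunctional_eigenvalueMeasure (laplacian_isSelfAdjoint Y hY) (K n)
      (le_max_right _ _))
    (isMomentFunctional_meanTrace (laplacian_isSelfAdjoint X hX) F (le_max_left _ _))
    (fun k => ?_) hφ
  simp only [realCalculus_pow (laplacian_isSelfAdjoint X hX), integral_pow_eigenvalueMeasure]
  exact tendsto_meanTrace_pow_of_good hK hF hd hXY (fun n => norm_compression_le (K n) _)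
    (fun n v hv => compression_laplacian_delta_eq_of_mem_good hv) k

theorem isDensityOfStates_of_meanTrace [Nonempty V] (hK : IsAmenableExhaustion X K)
    (hF : IsFundamentalDomain Γ F) (hd : IsEquidistributed Γ K F)
    (hXY : IsDensityZeroPerturbation K X Y hX hY) {N : ProbabilityMeasure ℝ}
    (hN : ∀ φ : ℝ → ℝ, Continuous φ → ((∫ t, φ t ∂(N : Measure ℝ) : ℝ) : ℂ) =
      meanTrace F (realCalculus φ (laplacian X hX))) :
    IsDensityOfStates K (laplacian Y hY) (laplacian_isSelfAdjoint Y hY) N where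
  finite_volume φ := by
    have h := tendsto_integral_eigenvalueMeasure hK hF hd hXY φ.continuous
    rw [← hN φ φ.continuous] at h
    exact (Complex.continuous_re.tendsto _).comp h
  trace φ := by
    rw [hN φ φ.continuous]
    exact tendsto_meanTrace_realCalculus hK hF hd hXY φ.continuous

theorem exists_isDensityOfStatesBottom [Nonempty V] (hK : IsAmenableExhaustion X K)
    (hF : IsFundamentalDomain Γ F) (hd : IsEquidistributed Γ K F)
    (hXY : IsDensityZeroPerturbation K X Y hX hY) :
    ∃ e : ℝ, IsDensityOfStatesBottom K (laplacian Y hY) (laplacian_isSelfAdjoint Y hY) e := by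
  obtain ⟨N, hN⟩ := exists_probabilityMeasure_meanTrace (laplacian_isSelfAdjoint X hX)
    hF.nonempty
  set M := ‖laplacian X hX‖ with hM
  have hbdd : BddBelow (N : Measure ℝ).support := by
    -- This function is positive exactly to the left of `-M`, where `Δ_X` has no spectrum; the cap
    -- at `1` makes it integrable.
    let φ : ℝ → ℝ := fun t => min 1 (max 0 (-M - t))
    have hφ : Continuous φ := by fun_prop
    have hφ0 : ∀ t, 0 ≤ φ t := fun t => le_min zero_le_one (le_max_left _ _)
    have h1 : ∫ t, φ t ∂(N : Measure ℝ) = 0 := by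
      have h := hN φ hφ
      rw [realCalculus_eq_zero le_rfl fun t ht => ?_] at h
      · simpa [meanTrace] using h
      · simp only [φ]
        rw [max_eq_left (by linarith [ht.1]), min_eq_right zero_le_one]
    have hint : Integrable φ (N : Measure ℝ) := by
      refine Integrable.of_bound hφ.aestronglyMeasurable 1 (ae_of_all _ fun t => ?_)
      rw [Real.norm_of_nonneg (hφ0 t)]
      exact min_le_left _ _
    have h2 := (integral_eq_zero_iff_of_nonneg hφ0 hint).1 h1
    refine ⟨-M, fun t ht => Measure.support_subset_of_isClosed isClosed_Ici ?_ ht⟩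
    filter_upwards [h2] with t ht
    by_contra hcon
    rw [Set.mem_Ici, not_le] at hcon
    have : 0 < φ t := lt_min one_pos (lt_max_of_lt_right (by linarith))
    exact this.ne' ht
  exact ⟨sInf (N : Measure ℝ).support, N, isDensityOfStates_of_meanTrace hK hF hd hXY hN,
    Real.isGLB_sInf (Measure.nonempty_support (IsProbabilityMeasure.ne_zero _)) hbdd⟩

end Periodic

/-! ### The ground state energy -/

section GroundEnergy

open scoped ComplexOrder

/-- Converts lower bounds on eigenvalues into positivity, which passes to principal submatrices.
That gives the monotonicity of lowest eigenvalues without a min-max principle. -/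
theorem _root_.Matrix.IsHermitian.posSemidef_sub_smul_one_iff {n : Type*} [Fintype n]
    [DecidableEq n] {A : Matrix n n ℂ} (hA : A.IsHermitian) (c : ℝ) :
    (A - (c : ℂ) • (1 : Matrix n n ℂ)).PosSemidef ↔ ∀ i, c ≤ hA.eigenvalues i := by
  constructor
  · intro h i
    have h1 := h.re_dotProduct_nonneg (hA.eigenvectorBasis i)
    have h2 : star ⇑(hA.eigenvectorBasis i) ⬝ᵥ ⇑(hA.eigenvectorBasis i) = (1 : ℂ) := by
      rw [dotProduct_comm, ← EuclideanSpace.inner_eq_star_dotProduct,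
        inner_self_eq_norm_sq_to_K, hA.eigenvectorBasis.norm_eq_one]
      simp
    rw [Matrix.sub_mulVec, dotProduct_sub, map_sub, ← hA.eigenvalues_eq, Matrix.smul_mulVec,
      Matrix.one_mulVec, dotProduct_smul, h2] at h1
    simpa using h1
  · intro h
    have h1 : A - (c : ℂ) • (1 : Matrix n n ℂ) = (hA.eigenvectorUnitary : Matrix n n ℂ) *
        Matrix.diagonal (fun i => ((hA.eigenvalues i - c : ℝ) : ℂ)) *
        (hA.eigenvectorUnitary : Matrix n n ℂ).conjTranspose := by
      have h2 : Matrix.diagonal (fun i => ((hA.eigenvalues i - c : ℝ) : ℂ)) =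
          Matrix.diagonal (RCLike.ofReal ∘ hA.eigenvalues) - (c : ℂ) • (1 : Matrix n n ℂ) := by
        rw [Matrix.smul_one_eq_diagonal, Matrix.diagonal_sub]
        congr 1
        funext i
        simp
      have h3 := hA.spectral_theorem
      rw [Unitary.conjStarAlgAut_apply] at h3
      rw [h2, mul_sub, sub_mul, ← Matrix.star_eq_conjTranspose, ← h3, mul_smul_comm, mul_one,
        smul_mul_assoc, Unitary.mul_star_self_of_mem hA.eigenvectorUnitary.2]
    rw [h1]
    refine Matrix.PosSemidef.mul_mul_conjTranspose_same (Matrix.PosSemidef.diagonal fun i => ?_) _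
    exact Complex.zero_le_real.2 (sub_nonneg.2 (h i))

variable {H : ℓ²(V, ℂ) →L[ℂ] ℓ²(V, ℂ)} (hH : IsSelfAdjoint H)

open scoped Classical in
theorem le_eigenvalues_truncation_of_subset {K K' : Finset V} (hKK : K ⊆ K') {c : ℝ}
    (h : ∀ i, c ≤ (truncation_isHermitian K' hH).eigenvalues i) (i : K) :
    c ≤ (truncation_isHermitian K hH).eigenvalues i := by
  revert i
  rw [← Matrix.IsHermitian.posSemidef_sub_smul_one_iff] at h ⊢
  have h1 := h.submatrix fun v : K => (⟨v, hKK v.2⟩ : K')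
  have h2 : Function.Injective fun v : K => (⟨v, hKK v.2⟩ : K') := fun v w hvw =>
    Subtype.ext (congrArg (fun u : K' => (u : V)) hvw)
  rw [Matrix.submatrix_sub, Pi.sub_apply, Pi.sub_apply, Matrix.submatrix_smul, Pi.smul_apply,
    Pi.smul_apply, Matrix.submatrix_one _ h2] at h1
  exact h1

open scoped Classical in
theorem support_eigenvalueMeasure (K : Finset V) :
    (eigenvalueMeasure K H hH).support =
      Set.range (truncation_isHermitian K hH).eigenvalues := by
  apply Set.Subset.antisymm
  · refine Measure.support_subset_of_isClosed (Set.finite_range _).isClosed ?_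
    rw [mem_ae_iff, eigenvalueMeasure, Measure.smul_apply, Measure.finsetSum_apply,
      Finset.sum_eq_zero, smul_zero]
    intro i _
    rw [Measure.dirac_apply' _ (Set.finite_range _).isClosed.measurableSet.compl]
    simp
  · rintro _ ⟨i, rfl⟩
    rw [Measure.mem_support_iff_forall]
    intro U hU
    rw [eigenvalueMeasure, Measure.smul_apply, Measure.finsetSum_apply, smul_eq_mul]
    refine ENNReal.mul_pos (ENNReal.inv_ne_zero.2 (ENNReal.natCast_ne_top _)) (ne_of_gt ?_)
    refine lt_of_lt_of_le ?_ (Finset.single_le_sum (fun _ _ => zero_le) (Finset.mem_univ i))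
    rw [Measure.dirac_apply_of_mem (mem_of_mem_nhds hU)]
    exact one_pos

/-- Nonemptiness matters: for empty `K` the support is empty and its `sInf` takes the default value
`0`. -/
theorem sInf_support_eigenvalueMeasure_le {K K' : Finset V} (hK : K.Nonempty) (hKK : K ⊆ K') :
    sInf (eigenvalueMeasure K' H hH).support ≤ sInf (eigenvalueMeasure K H hH).support := by
  classical
  have : Nonempty K := hK.to_subtype
  rw [support_eigenvalueMeasure, support_eigenvalueMeasure]
  refine le_csInf (Set.range_nonempty _) ?_
  rintro _ ⟨i, rfl⟩
  exact le_eigenvalues_truncation_of_subset hH hKK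
    (fun j => csInf_le (Set.finite_range _).bddBelow ⟨j, rfl⟩) i

variable (G : SimpleGraph V) [G.LocallyFinite] (hG : BoundedDegree G)

open scoped Classical in
theorem truncation_laplacian_apply (K : Finset V) (v w : K) :
    truncation K (laplacian G hG) v w =
      (if v = w then (G.degree (v : V) : ℂ) else 0) - if G.Adj v w then 1 else 0 := by
  rw [truncation, Matrix.of_apply, inner_delta, laplacian_delta, lp.coeFn_sub, Pi.sub_apply,
    lp.coeFn_smul, Pi.smul_apply, lp.coeFn_sum, Finset.sum_apply]
  simp only [delta_apply, smul_eq_mul, mul_ite, mul_one, mul_zero, Finset.sum_ite_eq,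
    SimpleGraph.mem_neighborFinset, Subtype.ext_iff, G.adj_comm (w : V)]
  congr 1
  split_ifs with h
  · rw [h]
  · rfl

open scoped Classical in
theorem eigenvalues_truncation_laplacian_nonneg (K : Finset V) (i : K) :
    0 ≤ (truncation_isHermitian K (laplacian_isSelfAdjoint G hG)).eigenvalues i := by
  set hA := truncation_isHermitian K (laplacian_isSelfAdjoint G hG)
  have hev : Module.End.HasEigenvalue (Matrix.toLin' (truncation K (laplacian G hG)))
      ((hA.eigenvalues i : ℝ) : ℂ) := by
    refine Module.End.hasEigenvalue_of_hasEigenvector (x := ⇑(hA.eigenvectorBasis i))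
      ⟨Module.End.mem_eigenspace_iff.2 ?_, ?_⟩
    · rw [Matrix.toLin'_apply, hA.mulVec_eigenvectorBasis]
      rfl
    · intro h0
      exact hA.eigenvectorBasis.orthonormal.ne_zero i (PiLp.ext fun j => congrFun h0 j)
  -- Gershgorin: the diagonal entry is the full degree in `G`, while the off-diagonal row sum counts
  -- only the neighbours inside `K`.
  obtain ⟨v, hv⟩ := eigenvalue_mem_ball hev
  rw [Metric.mem_closedBall, dist_eq_norm, truncation_laplacian_apply, if_pos rfl,
    if_neg (G.loopless.irrefl _), sub_zero] at hv
  have h1 : ∑ w ∈ Finset.univ.erase v, ‖truncation K (laplacian G hG) v w‖ ≤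
      (G.degree (v : V) : ℝ) := by
    have h2 : ∀ w ∈ Finset.univ.erase v, ‖truncation K (laplacian G hG) v w‖ =
        if G.Adj v w then 1 else 0 := by
      intro w hw
      rw [truncation_laplacian_apply, if_neg (Finset.ne_of_mem_erase hw).symm]
      split_ifs <;> simp
    rw [Finset.sum_congr rfl h2, ← Finset.sum_filter, Finset.sum_const, nsmul_eq_mul, mul_one,
      ← SimpleGraph.card_neighborFinset_eq_degree, Nat.cast_le]
    refine Finset.card_le_card_of_injOn (fun w => (w : V)) (fun w hw => ?_)
      Subtype.val_injective.injOn
    rw [Finset.mem_coe, SimpleGraph.mem_neighborFinset]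
    exact (Finset.mem_filter.1 hw).2
  have h3 := (Complex.abs_re_le_norm _).trans (hv.trans h1)
  rw [Complex.sub_re, Complex.ofReal_re, Complex.natCast_re] at h3
  linarith [(abs_le.1 h3).1]

theorem sInf_support_eigenvalueMeasure_laplacian_nonneg (K : Finset V) :
    0 ≤ sInf (eigenvalueMeasure K (laplacian G hG) (laplacian_isSelfAdjoint G hG)).support := by
  classical
  rw [support_eigenvalueMeasure]
  refine Real.sInf_nonneg ?_
  rintro _ ⟨i, rfl⟩
  exact eigenvalues_truncation_laplacian_nonneg G hG K i

theorem exists_isGroundEnergy_laplacian [Nonempty V] {K : ℕ → Finset V} (hmono : Monotone K)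
    (hex : ∀ v : V, ∃ n, v ∈ K n) :
    ∃ e : ℝ, IsGroundEnergy K (laplacian G hG) (laplacian_isSelfAdjoint G hG) e := by
  -- Shifting the sequence by `m` leaves only nonempty sets.
  obtain ⟨m, hm⟩ := hex (Classical.arbitrary V)
  have hanti : Antitone fun n => sInf (eigenvalueMeasure (K (n + m)) (laplacian G hG)
      (laplacian_isSelfAdjoint G hG)).support := fun n n' hn =>
    sInf_support_eigenvalueMeasure_le _ ⟨_, hmono (Nat.le_add_left m n) hm⟩
      (hmono (Nat.add_le_add_right hn m))
  have h := tendsto_atTop_ciInf hanti ⟨0, by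
    rintro _ ⟨n, rfl⟩
    exact sInf_support_eigenvalueMeasure_laplacian_nonneg G hG _⟩
  exact ⟨_, (tendsto_add_atTop_iff_nat m).1 h⟩

end GroundEnergy

/-! ### Absence of hidden spectrum -/

section NoHiddenSpectrum

open scoped ComplexOrder

theorem eq_zero_of_isPositive_of_inner_delta_eq_zero {T : ℓ²(V, ℂ) →L[ℂ] ℓ²(V, ℂ)}
    (hT : T.IsPositive) (h : ∀ v, ⟪delta v, T (delta v)⟫_ℂ = 0) : T = 0 := by
  have h1 : ∀ v, T (delta v) = 0 := fun v => by
    have h2 := norm_apply_sq_le_of_isPositive hT (delta v)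
    rw [h v, norm_zero, mul_zero] at h2
    exact norm_eq_zero.1 (pow_eq_zero_iff two_ne_zero |>.1 (le_antisymm h2 (sq_nonneg _)))
  refine ContinuousLinearMap.ext fun f => lp.ext (funext fun v => ?_)
  rw [← inner_delta, ← hT.inner_left_eq_inner_right, h1, inner_zero_left]
  rfl

variable {X : SimpleGraph V} [X.LocallyFinite] {hX : BoundedDegree X} {Γ : Subgroup (X ≃g X)}

theorem meanTrace_singleton (v : V) (T : ℓ²(V, ℂ) →L[ℂ] ℓ²(V, ℂ)) :
    meanTrace {v} T = ⟪delta v, T (delta v)⟫_ℂ := by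
  simp [meanTrace]

/-- Diagonal entries are mean traces over singletons, so equality of moments suffices. -/
theorem inner_realCalculus_laplacian_equiv (γ : X ≃g X) {φ : ℝ → ℝ} (hφ : Continuous φ) (v : V) :
    ⟪delta (γ v), realCalculus φ (laplacian X hX) (delta (γ v))⟫_ℂ =
      ⟪delta v, realCalculus φ (laplacian X hX) (delta v)⟫_ℂ := by
  rw [← meanTrace_singleton, ← meanTrace_singleton]
  refine meanTrace_realCalculus_eq (laplacian_isSelfAdjoint X hX) (fun k => ?_) hφ
  rw [meanTrace_singleton, meanTrace_singleton, inner_laplacian_pow_equiv]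

/-- Faithfulness of the trace: the nonnegative diagonal entries vanish on `F`, hence everywhere by
invariance, and a positive operator with zero diagonal is zero. -/
theorem realCalculus_laplacian_eq_zero_of_meanTrace {F : Finset V}
    (hF : IsFundamentalDomain Γ F) {φ : ℝ → ℝ} (hφ : Continuous φ) (hφ0 : ∀ t, 0 ≤ φ t)
    (h : meanTrace F (realCalculus φ (laplacian X hX)) = 0) :
    realCalculus φ (laplacian X hX) = 0 := by
  have hpos : (realCalculus φ (laplacian X hX)).IsPositive := isPositive_realCalculus hφ0
  refine eq_zero_of_isPositive_of_inner_delta_eq_zero hpos fun v => ?_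
  obtain ⟨x, ⟨hx, γ, _, rfl⟩, _⟩ := hF v
  rw [inner_realCalculus_laplacian_equiv γ hφ]
  rw [meanTrace, div_eq_zero_iff, Nat.cast_eq_zero, Finset.card_eq_zero] at h
  rcases h with h | h
  · exact (Finset.sum_eq_zero_iff_of_nonneg fun v _ => hpos.inner_nonneg_right _).1 h x hx
  · simp [h] at hx

/-- The Laplacian of the indicator of `K` vanishes at the vertices of `K` off the boundary and is at
most `d` on the boundary. -/
theorem re_inner_laplacian_indicator_le {d : ℕ} (hd : ∀ v, X.degree v ≤ d) (K : Finset V) :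
    (⟪∑ v ∈ K, delta v, laplacian X hX (∑ v ∈ K, delta v)⟫_ℂ).re ≤
      d * (boundary X K).card := by
  classical
  set f : ℓ²(V, ℂ) := ∑ v ∈ K, delta v with hf
  have hfv : ∀ v, f v = if v ∈ K then 1 else 0 := fun v => by
    have := sum_smul_delta_apply K (fun _ => 1) v
    simpa only [one_smul] using this
  have h1 : ∀ v ∈ K, (laplacian X hX f v).re ≤ if v ∈ boundary X K then (d : ℝ) else 0 := by
    intro v hv
    rw [laplacian_apply, Complex.re_sum]
    split_ifs with hb
    · calc ∑ w ∈ X.neighborFinset v, (f v - f w).re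
          ≤ ∑ w ∈ X.neighborFinset v, (1 : ℝ) := Finset.sum_le_sum fun w _ => by
            rw [hfv, hfv, if_pos hv]
            split_ifs <;> simp
        _ ≤ d := by simpa using hd v
    · refine le_of_eq (Finset.sum_eq_zero fun w hw => ?_)
      rw [SimpleGraph.mem_neighborFinset] at hw
      rw [hfv, hfv, if_pos hv, if_pos (mem_of_adj_of_notMem_boundary hv hb hw)]
      simp
  have h2 : (⟪f, laplacian X hX f⟫_ℂ).re = ∑ v ∈ K, (laplacian X hX f v).re := by
    conv_lhs => rw [hf, sum_inner, Complex.re_sum]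
    simp only [inner_delta, ← hf]
  rw [h2]
  refine (Finset.sum_le_sum h1).trans ?_
  rw [← Finset.sum_filter, Finset.sum_const, nsmul_eq_mul, mul_comm]
  gcongr
  exact fun v hv => (Finset.mem_filter.1 hv).2

theorem nonpos_of_le_re_inner_laplacian [Nonempty V] {K : ℕ → Finset V}
    (hK : IsAmenableExhaustion X K) {e : ℝ}
    (h : ∀ f, e * ‖f‖ ^ 2 ≤ (⟪f, laplacian X hX f⟫_ℂ).re) : e ≤ 0 := by
  obtain ⟨d, hd⟩ := hX
  have h1 := hK.boundary_ratio.const_mul (d : ℝ)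
  rw [mul_zero] at h1
  refine ge_of_tendsto h1 ?_
  filter_upwards [eventually_card_ne_zero hK] with n hn
  have h2 := (h (∑ v ∈ K n, delta v)).trans (re_inner_laplacian_indicator_le hd (K n))
  have h3 := norm_sq_sum_smul_delta (K n) fun _ => 1
  simp only [one_smul, norm_one, one_pow, Finset.sum_const, nsmul_eq_mul, mul_one,
    Finset.card_univ, Fintype.card_coe] at h3
  rw [Finset.sum_coe_sort (K n) delta] at h3
  rw [h3] at h2
  rw [← mul_div_assoc, le_div_iff₀ (lt_of_le_of_ne (Nat.cast_nonneg _) hn.symm)]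
  exact h2

theorem not_hasHiddenSpectrum_laplacian [Nonempty V] {Y : SimpleGraph V} [Y.LocallyFinite]
    {hY : BoundedDegree Y} {K : ℕ → Finset V} {F : Finset V} (hK : IsAmenableExhaustion X K)
    (hF : IsFundamentalDomain Γ F) (hd : IsEquidistributed Γ K F)
    (hXY : IsDensityZeroPerturbation K X Y hX hY) :
    ¬ HasHiddenSpectrum K (laplacian Y hY) (laplacian_isSelfAdjoint Y hY) := by
  rintro ⟨e₀, e₁, h₀, ⟨N, hN, hglb⟩, hlt⟩
  have he₀ : 0 ≤ e₀ := ge_of_tendsto' h₀ fun n =>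
    sInf_support_eigenvalueMeasure_laplacian_nonneg Y hY (K n)
  have he₁ : 0 < e₁ := he₀.trans_lt hlt
  set M := ‖laplacian X hX‖ with hM
  have hb : 0 ≤ e₁ + M := add_nonneg he₁.le (norm_nonneg _)
  -- The positive part of `e₁ - t`, capped to be bounded. The cap `e₁ + M` is not active for `t ≥
  -- -M`, hence not on the spectrum of `Δ_X`.
  let φ : ℝ →ᵇ ℝ := BoundedContinuousFunction.ofNormedAddCommGroup
    (fun t => max 0 (min (e₁ + M) (e₁ - t))) (by fun_prop) (e₁ + M) fun t => by
      rw [Real.norm_of_nonneg (le_max_left _ _)]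
      exact max_le hb (min_le_left _ _)
  have hφ : ∀ t, φ t = max 0 (min (e₁ + M) (e₁ - t)) := fun t => rfl
  have hint : ∫ t, φ t ∂(N : Measure ℝ) = 0 := by
    refine integral_eq_zero_of_ae ?_
    filter_upwards [Measure.support_mem_ae (μ := (N : Measure ℝ))] with t ht
    have := hglb.1 ht
    rw [hφ, Pi.zero_apply]
    exact max_eq_left ((min_le_right _ _).trans (by linarith))
  -- The measure `N` is arbitrary here; uniqueness of the limit of the traces identifies its
  -- integral of `φ` with the average over `F`.
  have h1 := hN.trace φ
  rw [hint] at h1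
  have h2 : meanTrace F (realCalculus φ (laplacian X hX)) = 0 := by
    simpa using tendsto_nhds_unique
      (tendsto_meanTrace_realCalculus hK hF hd hXY φ.continuous) h1
  have h3 := realCalculus_laplacian_eq_zero_of_meanTrace hF φ.continuous
    (fun t => (le_max_left _ _ : 0 ≤ φ t)) h2
  have h4 : e₁ ≤ 0 := by
    refine nonpos_of_le_re_inner_laplacian (hX := hX) hK fun f =>
      le_re_inner_of_realCalculus_eq_zero (laplacian_isSelfAdjoint X hX) le_rfl φ.continuous
        (fun t ht => ?_) h3 f
    rw [hφ]
    exact (le_min (by linarith [ht.1]) le_rfl).trans (le_max_right _ _)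
  exact absurd he₁ h4.not_gt

end NoHiddenSpectrum

end AmenableGraph

end

theorem mainTheorem11 {V : Type*} [Countable V] [Infinite V]
    (X Y : SimpleGraph V) [X.LocallyFinite] [Y.LocallyFinite]
    (hX : AmenableGraph.BoundedDegree X) (hY : AmenableGraph.BoundedDegree Y)
    (Γ : Subgroup (X ≃g X)) (hΓ : AmenableGraph.IsPeriodic X Γ)
    (K : ℕ → Finset V) (hK : AmenableGraph.IsAmenableExhaustion X K)
    (hKΓ : X.Connected ∨ AmenableGraph.IsTiledExhaustion Γ K)
    (hXY : AmenableGraph.IsDensityZeroPerturbation K X Y hX hY) :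
    (∃ e₀ : ℝ, AmenableGraph.IsGroundEnergy K (AmenableGraph.laplacian Y hY)
      (AmenableGraph.laplacian_isSelfAdjoint Y hY) e₀) ∧
    (∃ e₁ : ℝ, AmenableGraph.IsDensityOfStatesBottom K (AmenableGraph.laplacian Y hY)
      (AmenableGraph.laplacian_isSelfAdjoint Y hY) e₁) ∧
    ¬ AmenableGraph.HasHiddenSpectrum K (AmenableGraph.laplacian Y hY)
      (AmenableGraph.laplacian_isSelfAdjoint Y hY) := by
  obtain ⟨F, hF, hd⟩ := AmenableGraph.exists_isFundamentalDomain_tendsto hΓ hK hKΓ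
  exact ⟨AmenableGraph.exists_isGroundEnergy_laplacian Y hY hK.mono hK.exhausts,
    AmenableGraph.exists_isDensityOfStatesBottom hK hF hd hXY,
    AmenableGraph.not_hasHiddenSpectrum_laplacian hK hF hd hXY⟩
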